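/- For $s\in\mathbb R$ write $\|u\|_{H^s}^2=\int_{\mathbb R^3}(1+|\xi|^2)^s|\hat u(\xi)|^2\,d\xi$, where $\hat u(\xi)=\int_{\mathbb R^3}e^{-2\pi i x\cdot\xi}u(x)\,dx$, and let $H^{1/2}=H^{1/2}(\mathbb R^3)$ be the space of complex-valued $u\in L^2(\mathbb R^3)$ with $\|u\|_{H^{1/2}}<\infty$. For $\alpha,\beta,\rho>0$ let $$\mathcal E^{\alpha,\beta}(u)=\frac12\|u\|_{H^{1/2}}^2+\alpha\iint_{\mathbb R^3\times\mathbb R^3}\frac{|u(x)|^2|u(y)|^2}{|x-y|}\,dx\,dy-\beta\int_{\mathbb R^3}|u|^{8/3}\,dx ,$$ $$S(\rho)=\Big\{u\in H^{1/2}:\ \int_{\mathbb R^3}|u|^2\,dx=\rho\Big\},\qquad I^{\alpha,\beta}(\rho)=\inf_{u\in S(\rho)}\mathcal E^{\alpha,\beta}(u)\in[-\infty,\infty).$$ **Theorem.** For all $\alpha,\beta>0$ there is $\bar\rho=\bar\rho(\alpha,\beta)>0$ such that for every $0<\rho<\bar\rho$: 1. $I^{\alpha,\beta}(\rho)\ge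 0$. 2. For every sequence $u_n\in S(\rho)$ with $\mathcal E^{\alpha,\beta}(u_n)\to I^{\alpha,\beta}(\rho)$ there are a subsequence $(u_{n_k})$ and translations $\tau_k\in\mathbb R^3$ such that $u_{n_k}(\cdot+\tau_k)$ converges strongly in $H^{1/2}$. 3. There is $v\in S(\rho)$ with $\mathcal E^{\alpha,\beta}(v)=I^{\alpha,\beta}(\rho)$, and every such minimizer $v$ satisfies $$\frac12\|v\|_{H^{1/2}}^2-\frac12\|v\|_{H^{-1/2}}^2+\alpha\iint_{\mathbb R^3\times\mathbb R^3}\frac{|v(x)|^2|v(y)|^2}{|x-y|}\,dx\,dy-\beta\int_{\mathbb R^3}|v|^{8/3}\,dx=0 .$$ -/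

import Mathlib

open MeasureTheory Filter Topology
open scoped FourierTransform

noncomputable section

/-- Euclidean space `ℝ³`. -/
abbrev R3 : Type := EuclideanSpace ℝ (Fin 3)

/-- Complex-valued `L²(ℝ³)` (classes modulo a.e. equality, Lebesgue measure). -/
abbrev L2R3 : Type := Lp ℂ 2 (volume : Measure R3)

/-- The density `(1 + |ξ|²)^s |û(ξ)|²`; here `û = 𝓕 u` is the Fourier transform on `L²`, the
isometric extension of `û(ξ) = ∫ e^{-2πi x·ξ} u(x) dx`. -/
def sobolevDensity (s : ℝ) (u : L2R3) (ξ : R3) : ℝ :=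
  (1 + ‖ξ‖ ^ 2) ^ s * ‖(𝓕 u : L2R3) ξ‖ ^ 2

/-- The squared Sobolev norm `‖u‖²_{H^s} = ∫ (1 + |ξ|²)^s |û(ξ)|² dξ`. It is used only where the
integral is finite: for `u ∈ H^{1/2}` with `s = 1/2`, and for `u ∈ L²` with `s = -1/2`. -/
def sobolevNormSq (s : ℝ) (u : L2R3) : ℝ :=
  ∫ ξ, sobolevDensity s u ξ

/-- The space `H^{1/2}(ℝ³)`: the `u ∈ L²` with `∫ (1 + |ξ|²)^{1/2} |û(ξ)|² dξ < ∞`. -/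
def Hhalf : Set L2R3 :=
  {u | Integrable (sobolevDensity (1 / 2) u)}

/-- The Coulomb energy `∬ |u(x)|² |u(y)|² / |x - y| dx dy`
(finite on `H^{1/2}`, by the Sobolev and Hardy-Littlewood-Sobolev inequalities). -/
def coulomb (u : L2R3) : ℝ :=
  ∫ z : R3 × R3, ‖u z.1‖ ^ 2 * ‖u z.2‖ ^ 2 / ‖z.1 - z.2‖

/-- `‖u‖_p^p = ∫ |u|^p dx` (finite on `H^{1/2}` for `2 ≤ p ≤ 3`). -/
def lpPow (p : ℝ) (u : L2R3) : ℝ :=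
  ∫ x, ‖u x‖ ^ p

/-- The energy `½ ‖u‖²_{H^{1/2}} + α ∬ |u(x)|² |u(y)|² / |x - y| dx dy - β ∫ |u|^p dx`. -/
def energy (α β p : ℝ) (u : L2R3) : ℝ :=
  1 / 2 * sobolevNormSq (1 / 2) u + α * coulomb u - β * lpPow p u

/-- The constraint set `S(ρ)`: all `u ∈ H^{1/2}` with `∫ |u|² dx = ρ`. -/
def massSphere (ρ : ℝ) : Set L2R3 :=
  {u | u ∈ Hhalf ∧ ∫ x, ‖u x‖ ^ 2 = ρ}

/-- The infimum of the energy on `S(ρ)`, in the extended reals, so that it is `-∞` when the energy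
is not bounded below on `S(ρ)`. -/
def infEnergy (α β p ρ : ℝ) : EReal :=
  ⨅ u ∈ massSphere ρ, (energy α β p u : EReal)

/-- `v` is a minimizer of the energy on `S(ρ)`. -/
def IsEnergyMinimizer (α β p ρ : ℝ) (v : L2R3) : Prop :=
  v ∈ massSphere ρ ∧ (energy α β p v : EReal) = infEnergy α β p ρ

/-- `u` is a minimizing sequence: `u n ∈ S(ρ)` and the energies converge to the infimum. -/
def IsMinimizingSeq (α β p ρ : ℝ) (u : ℕ → L2R3) : Prop :=
  (∀ n, u n ∈ massSphere ρ) ∧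
    Tendsto (fun n => (energy α β p (u n) : EReal)) atTop (𝓝 (infEnergy α β p ρ))

/-- The translate `u(· + τ)`. -/
def translateL2 (τ : R3) (u : L2R3) : L2R3 :=
  Lp.compMeasurePreserving (fun x => x + τ) (measurePreserving_add_right volume τ) u

/-- Strong convergence `w n → w` in `H^{1/2}`. -/
def TendstoHhalf (w : ℕ → L2R3) (w' : L2R3) : Prop :=
  (∀ n, w n ∈ Hhalf) ∧ w' ∈ Hhalf ∧
    Tendsto (fun n => sobolevNormSq (1 / 2) (w n - w')) atTop (𝓝 0)

end

noncomputable section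

/-! Write K, C, P for the squared H^{1/2} norm, the Coulomb energy and the 8/3-power integral, so
that E = K/2 + αC − βP.

Coercivity. The Gagliardo–Nirenberg inequality P ≤ c‖u‖₂^{2/3}K (`lintegral_rpow_le`) lets K absorb
βP when ρ is small, whence E ≥ K/4 (`quarter_sobolevNormSq_le_energy`). So the infimum I is
nonnegative and minimizing sequences are bounded.

No dichotomy. Under u ↦ √s·u the terms K, C, P scale as s, s², s^{4/3}. Since C ≤ c‖u‖₂^{4/3}P
(`coulomb_le`), at small mass the gain from P beats the loss from C, and energy per unit mass
strictly decreases when s > 1 (`exists_massSphere_energy_lt`).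

No vanishing. If P tended to 0 along a minimizing sequence, then I ≥ ρ/2, because K ≥ ρ. Spreading
out a fixed band-limited function by a factor 1/λ costs O(λ²) in K and gains a multiple of λ in βP −
αC, so I < ρ/2 (`exists_massSphere_energy_lt_half`). Hence P stays away from 0, some low-frequency
part is bounded below at a point (`exists_lowFun_ge`), and translating that point to the origin
gives a nonzero weak limit v.

Conclusion. With r_n = u_n − v, the mass splits and E(v) + E(r_n) ≤ E(u_n) + o(1), by weak
convergence in a Hilbert space for K, Brezis–Lieb for P and near-diagonal estimates for C
(`exists_splitting`). Strict decrease of energy per mass forces ‖v‖₂² = ρ and E(v) = I; then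
K(r_n)/4 ≤ E(r_n) → 0 is strong convergence. The identity for minimizers is the vanishing derivative
of E along the mass-preserving dilations a^{3/2}v(a·) at a = 1. -/

/-! ### The Fourier transform on L² as an integral. -/

theorem ae_eq_of_forall_schwartz {u : L2R3} {g : R3 → ℂ} (hg : LocallyIntegrable g)
    (h : ∀ ψ : SchwartzMap R3 ℂ, ∫ x, ψ x • u x = ∫ x, ψ x • g x) : u =ᵐ[volume] g := by
  refine ae_eq_of_integral_contDiff_smul_eq ((Lp.memLp u).locallyIntegrable (by norm_num)) hg ?_
  intro φ hφ hc
  have hg₁ : HasCompactSupport (Complex.ofRealCLM ∘ φ) := hc.comp_left rfl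
  have hg₂ : ContDiff ℝ (↑(⊤ : ℕ∞)) (Complex.ofRealCLM ∘ φ) := by fun_prop
  have := h (hg₁.toSchwartzMap hg₂)
  simpa using this

theorem fourier_continuous {g : R3 → ℂ} (h1 : Integrable g) : Continuous (𝓕 g) := by
  rw [← Real.fourierTransform_toLp (memLp_one_iff_integrable.2 h1)]
  exact BoundedContinuousFunction.continuous _

theorem fourierInv_continuous {g : R3 → ℂ} (h1 : Integrable g) : Continuous (𝓕⁻ g) := by
  rw [← Real.Lp.fourierTransformInv_toLp (memLp_one_iff_integrable.2 h1)]
  exact BoundedContinuousFunction.continuous _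

/-- The L² transform is compatible with that of tempered distributions, so it can be tested against
Schwartz functions; there the integral transform satisfies the same duality ∫ ψ̂ g = ∫ ψ ĝ. -/
theorem fourier_toLp_ae_eq {g : R3 → ℂ} (h1 : Integrable g) (h2 : MemLp g 2) :
    (𝓕 (h2.toLp g) : L2R3) =ᵐ[volume] 𝓕 g := by
  refine ae_eq_of_forall_schwartz (fourier_continuous h1).locallyIntegrable fun ψ => ?_
  have e1 := congrArg (fun T => T ψ) (Lp.fourier_toTemperedDistribution_eq (h2.toLp g))
  simp only [TemperedDistribution.fourier_apply, Lp.toTemperedDistribution_apply] at e1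
  rw [← e1]
  have e2 := VectorFourier.integral_fourierIntegral_smul_eq_flip (L := innerₗ R3)
    (μ := volume) (ν := volume) (e := Real.fourierChar) Real.continuous_fourierChar continuous_inner
    ψ.integrable h1
  have e3 : ∫ x, (𝓕 ψ) x • (h2.toLp g) x = ∫ x, (𝓕 ψ) x • g x := by
    refine integral_congr_ae ?_
    filter_upwards [h2.coeFn_toLp] with x hx
    rw [hx]
  rw [e3, SchwartzMap.fourier_coe]
  rw [flip_innerₗ] at e2
  exact e2

theorem fourierInv_toLp_ae_eq {g : R3 → ℂ} (h1 : Integrable g) (h2 : MemLp g 2) :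
    (𝓕⁻ (h2.toLp g) : L2R3) =ᵐ[volume] 𝓕⁻ g := by
  refine ae_eq_of_forall_schwartz (fourierInv_continuous h1).locallyIntegrable fun ψ => ?_
  have e1 := congrArg (fun T => T ψ) (Lp.fourierInv_toTemperedDistribution_eq (h2.toLp g))
  simp only [TemperedDistribution.fourierInv_apply, Lp.toTemperedDistribution_apply] at e1
  rw [← e1]
  have e2 := VectorFourier.integral_fourierIntegral_smul_eq_flip (L := -innerₗ R3)
    (μ := volume) (ν := volume) (e := Real.fourierChar) Real.continuous_fourierChar
    (continuous_inner (𝕜 := ℝ) (E := R3)).neg ψ.integrable h1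
  have e3 : ∫ x, (𝓕⁻ ψ) x • (h2.toLp g) x = ∫ x, (𝓕⁻ ψ) x • g x := by
    refine integral_congr_ae ?_
    filter_upwards [h2.coeFn_toLp] with x hx
    rw [hx]
  rw [e3]
  have e4 : (-innerₗ R3).flip = -innerₗ R3 := by
    ext x y; simp [real_inner_comm]
  rw [e4] at e2
  rw [SchwartzMap.fourierInv_coe]
  exact e2
-- Affine changes of variables on L² and their Fourier transforms.
theorem map_affine {a : ℝ} (ha : 0 < a) (τ : R3) :
    Measure.map (fun x : R3 => a • x + τ) volume = ENNReal.ofReal (a ^ 3)⁻¹ • volume := by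
  have h1 : Measure.map (fun x : R3 => a • x) volume = ENNReal.ofReal (a ^ 3)⁻¹ • volume := by
    rw [Measure.map_addHaar_smul _ ha.ne']
    simp [abs_of_pos ha]
  have : (fun x : R3 => a • x + τ) = (fun x => x + τ) ∘ (fun x => a • x) := rfl
  rw [this, ← Measure.map_map (measurable_add_const τ) (measurable_const_smul a), h1,
    Measure.map_smul, (measurePreserving_add_right volume τ).map_eq]

theorem measurableEmbedding_affine {a : ℝ} (ha : 0 < a) (τ : R3) :
    MeasurableEmbedding (fun x : R3 => a • x + τ) :=
  (measurableEmbedding_addRight τ).comp (measurableEmbedding_const_smul₀ ha.ne')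

theorem lintegral_affine {a : ℝ} (ha : 0 < a) (τ : R3) (f : R3 → ENNReal) :
    ∫⁻ x, f (a • x + τ) = ENNReal.ofReal (a ^ 3)⁻¹ * ∫⁻ x, f x := by
  rw [← (measurableEmbedding_affine ha τ).lintegral_map f, map_affine ha, lintegral_smul_measure,
    smul_eq_mul]

theorem integral_affine {E : Type*} [NormedAddCommGroup E] [NormedSpace ℝ E] {a : ℝ} (ha : 0 < a)
    (τ : R3) (f : R3 → E) : ∫ x, f (a • x + τ) = (a ^ 3)⁻¹ • ∫ x, f x := by
  rw [← (measurableEmbedding_affine ha τ).integral_map f, map_affine ha, integral_smul_measure,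
    ENNReal.toReal_ofReal (by positivity)]

theorem quasiMeasurePreserving_affine {a : ℝ} (ha : 0 < a) (τ : R3) :
    Measure.QuasiMeasurePreserving (fun x : R3 => a • x + τ) := by
  refine ⟨(measurableEmbedding_affine ha τ).measurable, ?_⟩
  rw [map_affine ha]
  exact Measure.smul_absolutelyContinuous

section weightedComp
variable {a : ℝ} {τ : R3} {m : R3 → ℂ}

theorem eLpNorm_weightedComp (ha : 0 < a) (hn : ∀ x, ‖m x‖ ^ 2 = a ^ 3) (u : R3 → ℂ) :
    eLpNorm (fun x => m x * u (a • x + τ)) 2 volume = eLpNorm u 2 volume := by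
  have h2 : ENNReal.toReal 2 = 2 := by simp
  rw [eLpNorm_eq_lintegral_rpow_enorm_toReal (by norm_num) (by norm_num),
    eLpNorm_eq_lintegral_rpow_enorm_toReal (by norm_num) (by norm_num), h2]
  congr 1
  have : ∀ x, ‖m x * u (a • x + τ)‖ₑ ^ (2 : ℝ)
      = ENNReal.ofReal (a ^ 3) * ‖u (a • x + τ)‖ₑ ^ (2 : ℝ) := by
    intro x
    rw [enorm_mul, ENNReal.mul_rpow_of_nonneg _ _ (by norm_num), ← hn x,
      ENNReal.ofReal_pow (norm_nonneg _), ofReal_norm]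
    norm_cast
  simp_rw [this]
  rw [lintegral_const_mul' _ _ ENNReal.ofReal_ne_top, lintegral_affine ha τ (fun x => ‖u x‖ₑ ^ (2 : ℝ)),
    ← mul_assoc, ← ENNReal.ofReal_mul (by positivity), mul_inv_cancel₀ (by positivity)]
  simp

theorem memLp_weightedComp (ha : 0 < a) (hm : Measurable m) (hn : ∀ x, ‖m x‖ ^ 2 = a ^ 3)
    {u : R3 → ℂ} (hu : MemLp u 2) : MemLp (fun x => m x * u (a • x + τ)) 2 := by
  refine ⟨hm.aestronglyMeasurable.mul
    (hu.1.comp_quasiMeasurePreserving (quasiMeasurePreserving_affine ha τ)), ?_⟩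
  rw [eLpNorm_weightedComp ha hn]
  exact hu.2

/-- The isometry `u ↦ m(x) u(a x + τ)` of `L²`, where `|m|² = a³`. -/
def weightedComp (ha : 0 < a) (τ : R3) (hm : Measurable m) (hn : ∀ x, ‖m x‖ ^ 2 = a ^ 3) :
    L2R3 →ₗᵢ[ℂ] L2R3 where
  toFun u := (memLp_weightedComp (τ := τ) ha hm hn (Lp.memLp u)).toLp _
  map_add' u v := by
    rw [← MemLp.toLp_add]
    refine MemLp.toLp_congr _ _ ?_
    filter_upwards [(quasiMeasurePreserving_affine ha τ).ae (Lp.coeFn_add u v)] with x hx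
    change m x * (u + v : L2R3) (a • x + τ) = m x * u (a • x + τ) + m x * v (a • x + τ)
    rw [hx, Pi.add_apply, mul_add]
  map_smul' c u := by
    rw [← MemLp.toLp_const_smul]
    refine MemLp.toLp_congr _ _ ?_
    filter_upwards [(quasiMeasurePreserving_affine ha τ).ae (Lp.coeFn_smul c u)] with x hx
    change m x * (c • u : L2R3) (a • x + τ) = c • (m x * u (a • x + τ))
    rw [hx, Pi.smul_apply, smul_eq_mul, smul_eq_mul, mul_left_comm]
  norm_map' u := by
    change ‖(memLp_weightedComp (τ := τ) ha hm hn (Lp.memLp u)).toLp _‖ = _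
    rw [Lp.norm_toLp, eLpNorm_weightedComp ha hn, Lp.norm_def]

theorem coeFn_weightedComp (ha : 0 < a) (hm : Measurable m) (hn : ∀ x, ‖m x‖ ^ 2 = a ^ 3)
    (u : L2R3) : weightedComp ha τ hm hn u =ᵐ[volume] fun x => m x * u (a • x + τ) :=
  MemLp.coeFn_toLp (memLp_weightedComp (τ := τ) ha hm hn (Lp.memLp u))

end weightedComp

theorem norm_affine_const {a : ℝ} (ha : 0 < a) : ‖((a ^ (3 / 2 : ℝ) : ℝ) : ℂ)‖ ^ 2 = a ^ 3 := by
  rw [Complex.norm_real, Real.norm_eq_abs, sq_abs, ← Real.rpow_natCast, ← Real.rpow_mul ha.le]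
  norm_num

/-- The mass-preserving affine change of variables `u ↦ a^{3/2} u(a x + τ)`. -/
def affineL2 {a : ℝ} (ha : 0 < a) (τ : R3) : L2R3 →ₗᵢ[ℂ] L2R3 :=
  weightedComp ha τ (m := fun _ => ((a ^ (3 / 2 : ℝ) : ℝ) : ℂ)) measurable_const
    fun _ => norm_affine_const ha

theorem coeFn_affineL2 {a : ℝ} (ha : 0 < a) (τ : R3) (u : L2R3) :
    affineL2 ha τ u =ᵐ[volume] fun x => ((a ^ (3 / 2 : ℝ) : ℝ) : ℂ) * u (a • x + τ) :=
  coeFn_weightedComp _ _ _ _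

theorem translateL2_eq_affineL2 (τ : R3) (u : L2R3) :
    translateL2 τ u = affineL2 one_pos τ u := by
  refine Lp.ext ?_
  filter_upwards [coeFn_affineL2 one_pos τ u,
    Lp.coeFn_compMeasurePreserving u (measurePreserving_add_right volume τ)] with x h1 h2
  rw [h1, translateL2, h2]
  simp

theorem fourier_affine {a : ℝ} (ha : 0 < a) (τ : R3) (f : R3 → ℂ) (ξ : R3) :
    𝓕 (fun x => ((a ^ (3 / 2 : ℝ) : ℝ) : ℂ) * f (a • x + τ)) ξ =
      (((a⁻¹ ^ (3 / 2 : ℝ) : ℝ) : ℂ) * ((Real.fourierChar (a⁻¹ * inner ℝ τ ξ) : Circle) : ℂ)) *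
        𝓕 f (a⁻¹ • ξ) := by
  rw [Real.fourier_eq, Real.fourier_eq]
  obtain ⟨c, hc⟩ : ∃ c : ℂ, c = ((Real.fourierChar (a⁻¹ * inner ℝ τ ξ) : Circle) : ℂ) := ⟨_, rfl⟩
  obtain ⟨g, hg⟩ : ∃ g : R3 → ℂ, g = fun y => Real.fourierChar (-inner ℝ y (a⁻¹ • ξ)) • f y :=
    ⟨_, rfl⟩
  have h1 : ∀ x : R3, Real.fourierChar (-inner ℝ x ξ) •
      (((a ^ (3 / 2 : ℝ) : ℝ) : ℂ) * f (a • x + τ)) =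
      (((a ^ (3 / 2 : ℝ) : ℝ) : ℂ) * c) * g (a • x + τ) := by
    intro x
    have : -inner ℝ x ξ = a⁻¹ * inner ℝ τ ξ + -inner ℝ (a • x + τ) (a⁻¹ • ξ) := by
      rw [inner_add_left, real_inner_smul_left, real_inner_smul_right, real_inner_smul_right]
      field_simp
      ring
    rw [this, AddChar.map_add_eq_mul, hg, hc]
    simp only [Circle.smul_def, Circle.coe_mul, smul_eq_mul]
    ring
  rw [integral_congr_ae (ae_of_all _ h1), ← hc, ← hg, integral_const_mul, integral_affine ha τ,
    Complex.real_smul]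
  have h2 : (((a ^ (3 / 2 : ℝ) : ℝ) : ℂ)) * (((a ^ 3)⁻¹ : ℝ) : ℂ)
      = ((a⁻¹ ^ (3 / 2 : ℝ) : ℝ) : ℂ) := by
    rw [← Complex.ofReal_mul, Real.inv_rpow ha.le, ← Real.rpow_natCast, ← Real.rpow_neg ha.le,
      ← Real.rpow_neg ha.le, ← Real.rpow_add ha]
    norm_num
  rw [← h2]
  ring

/-- The Fourier transform turns a mass-preserving affine change of variables into a modulated
dilation. -/
theorem fourier_affineL2 {a : ℝ} (ha : 0 < a) (τ : R3) (u : L2R3) :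
    (𝓕 (affineL2 ha τ u) : L2R3) =ᵐ[volume] fun ξ =>
      (((a⁻¹ ^ (3 / 2 : ℝ) : ℝ) : ℂ) * ((Real.fourierChar (a⁻¹ * inner ℝ τ ξ) : Circle) : ℂ)) *
        (𝓕 u : L2R3) (a⁻¹ • ξ) := by
  have hm : Measurable fun ξ : R3 =>
      (((a⁻¹ ^ (3 / 2 : ℝ) : ℝ) : ℂ) * ((Real.fourierChar (a⁻¹ * inner ℝ τ ξ) : Circle) : ℂ)) := by
    refine Continuous.measurable ?_
    fun_prop
  have hn : ∀ ξ : R3, ‖(((a⁻¹ ^ (3 / 2 : ℝ) : ℝ) : ℂ) *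
      ((Real.fourierChar (a⁻¹ * inner ℝ τ ξ) : Circle) : ℂ))‖ ^ 2 = a⁻¹ ^ 3 := by
    intro ξ
    rw [norm_mul, Circle.norm_coe, mul_one, norm_affine_const (inv_pos.2 ha)]
  -- Both sides are isometries in u, so it suffices to compare them on the dense Schwartz class,
  -- where the transform is an integral.
  have key : ∀ u : L2R3, 𝓕 (affineL2 ha τ u) = weightedComp (inv_pos.2 ha) 0 hm hn (𝓕 u) := by
    intro u
    refine DenseRange.induction_on
      (SchwartzMap.denseRange_toLpCLM (p := 2) (F := ℂ) (E := R3) (μ := volume)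
        ENNReal.ofNat_ne_top) u ?_ ?_
    · refine isClosed_eq ?_ ?_
      · exact (Lp.fourierTransformₗᵢ R3 ℂ).continuous.comp (affineL2 ha τ).continuous
      · exact (weightedComp (inv_pos.2 ha) 0 hm hn).continuous.comp
          (Lp.fourierTransformₗᵢ R3 ℂ).continuous
    · intro f
      change 𝓕 (affineL2 ha τ (f.toLp 2)) = weightedComp (inv_pos.2 ha) 0 hm hn (𝓕 (f.toLp 2))
      rw [SchwartzMap.toLp_fourier_eq]
      have h2 : MemLp (fun x => ((a ^ (3 / 2 : ℝ) : ℝ) : ℂ) * f (a • x + τ)) 2 :=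
        memLp_weightedComp ha measurable_const (fun _ => norm_affine_const ha) (f.memLp 2 volume)
      have h1 : Integrable (fun x => ((a ^ (3 / 2 : ℝ) : ℝ) : ℂ) * f (a • x + τ)) := by
        refine Integrable.const_mul ?_ _
        have := (measurableEmbedding_affine ha τ).integrable_map_iff (g := f) (μ := volume)
        rw [map_affine ha] at this
        exact this.1 (f.integrable.smul_measure ENNReal.ofReal_ne_top)
      have e1 : affineL2 ha τ (f.toLp 2) = h2.toLp _ := by
        refine Lp.ext ?_
        filter_upwards [coeFn_affineL2 ha τ (f.toLp 2), h2.coeFn_toLp,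
          (quasiMeasurePreserving_affine ha τ).ae (f.coeFn_toLp 2 volume)] with x h3 h4 h5
        rw [h3, h4, h5]
      rw [e1]
      refine Lp.ext ?_
      filter_upwards [fourier_toLp_ae_eq h1 h2, coeFn_weightedComp (τ := 0) (inv_pos.2 ha) hm hn
        ((𝓕 f).toLp 2), (quasiMeasurePreserving_affine (inv_pos.2 ha) 0).ae
          ((𝓕 f).coeFn_toLp 2 volume)] with ξ h3 h4 h5
      rw [h3, h4, h5, fourier_affine ha, SchwartzMap.fourier_coe]
      simp
  rw [key u]
  filter_upwards [coeFn_weightedComp (τ := 0) (inv_pos.2 ha) hm hn (𝓕 u)] with ξ h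
  rw [h, add_zero]

/-! ### Low-frequency truncation. -/

theorem integrable_norm_sq (u : L2R3) : Integrable fun x => ‖u x‖ ^ 2 :=
  (Lp.memLp u).integrable_norm_pow (p := 2) (by norm_num)

theorem integral_norm_sq (u : L2R3) : ∫ x, ‖u x‖ ^ 2 = ‖u‖ ^ 2 := by
  have h := L2.inner_def (𝕜 := ℂ) u u
  have h2 : (inner ℂ u u : ℂ) = ((∫ x, ‖u x‖ ^ 2 : ℝ) : ℂ) := by
    rw [h, ← integral_complex_ofReal]
    refine integral_congr_ae (ae_of_all _ fun x => ?_)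
    simp [inner_self_eq_norm_sq_to_K]
  rw [inner_self_eq_norm_sq_to_K] at h2
  refine (Complex.ofReal_injective ?_).symm
  rw [← h2]
  simp

theorem lintegral_norm_sq (u : L2R3) : ∫⁻ x, ENNReal.ofReal (‖u x‖ ^ 2) = ENNReal.ofReal (‖u‖ ^ 2) := by
  rw [← integral_norm_sq, ofReal_integral_eq_lintegral_ofReal (integrable_norm_sq u)
    (ae_of_all _ fun x => by positivity)]

theorem memLp_indicator_fourier {s : Set R3} (hs : MeasurableSet s) (u : L2R3) :
    MemLp (s.indicator (𝓕 u : L2R3)) 2 := (Lp.memLp _).indicator hs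

/-- The part of `u` with frequencies in the ball of radius `A`. -/
def lowFreq (A : ℝ) (u : L2R3) : L2R3 :=
  𝓕⁻ ((memLp_indicator_fourier (measurableSet_ball (x := (0 : R3)) (ε := A)) u).toLp _)

theorem fourier_lowFreq (A : ℝ) (u : L2R3) :
    (𝓕 (lowFreq A u) : L2R3) =ᵐ[volume] (Metric.ball 0 A).indicator (𝓕 u : L2R3) := by
  rw [lowFreq, FourierInvPair.fourier_fourierInv_eq]
  exact MemLp.coeFn_toLp _

theorem fourier_sub_lowFreq (A : ℝ) (u : L2R3) :
    (𝓕 (u - lowFreq A u) : L2R3) =ᵐ[volume] (Metric.ball 0 A)ᶜ.indicator (𝓕 u : L2R3) := by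
  have : 𝓕 (u - lowFreq A u) = 𝓕 u - 𝓕 (lowFreq A u) :=
    (Lp.fourierTransformₗᵢ R3 ℂ).map_sub u _
  rw [this]
  filter_upwards [Lp.coeFn_sub (𝓕 u) (𝓕 (lowFreq A u)), fourier_lowFreq A u] with ξ h1 h2
  rw [h1, Pi.sub_apply, h2, Set.indicator_compl]
  rfl

theorem memLp_waveKernel (A : ℝ) (x : R3) :
    MemLp ((Metric.ball (0 : R3) A).indicator
      fun ξ => ((Real.fourierChar (-inner ℝ ξ x) : Circle) : ℂ)) 2 := by
  have hm : Measurable fun ξ : R3 => ((Real.fourierChar (-inner ℝ ξ x) : Circle) : ℂ) := by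
    refine Continuous.measurable ?_
    fun_prop
  have h1 : MemLp ((Metric.ball (0 : R3) A).indicator fun _ => (1 : ℝ)) 2 :=
    memLp_indicator_const 2 measurableSet_ball 1 (Or.inr measure_ball_lt_top.ne)
  refine h1.mono (hm.aestronglyMeasurable.indicator measurableSet_ball) (ae_of_all _ fun ξ => ?_)
  by_cases hξ : ξ ∈ Metric.ball (0 : R3) A
  · simpa [hξ] using (Circle.norm_coe _).le
  · simp [hξ]

/-- The truncated plane wave representing the low-frequency part at a point. -/
def waveKernel (A : ℝ) (x : R3) : L2R3 := (memLp_waveKernel A x).toLp _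

/-- The low-frequency part of `u` as a genuine function. -/
def lowFun (A : ℝ) (u : L2R3) (x : R3) : ℂ := inner ℂ (waveKernel A x) (𝓕 u)

/-- The inner product defining `lowFun` turns weak convergence into pointwise convergence; the
integral form obtained here gives continuity and agreement with `lowFreq`. -/
theorem lowFun_eq_fourierInv (A : ℝ) (u : L2R3) :
    lowFun A u = 𝓕⁻ ((Metric.ball 0 A).indicator (𝓕 u : L2R3) : R3 → ℂ) := by
  ext x
  rw [lowFun, L2.inner_def, Real.fourierInv_eq]
  refine integral_congr_ae ?_
  filter_upwards [(memLp_waveKernel A x).coeFn_toLp] with ξ h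
  rw [waveKernel, h]
  by_cases hξ : ξ ∈ Metric.ball (0 : R3) A
  · simp only [Set.indicator_of_mem hξ, Circle.smul_def, smul_eq_mul, RCLike.inner_apply,
      ← Circle.coe_inv_eq_conj, AddChar.map_neg_eq_inv, inv_inv]
    ring
  · simp [hξ]

theorem integrable_indicator_fourier (A : ℝ) (u : L2R3) :
    Integrable ((Metric.ball 0 A).indicator (𝓕 u : L2R3) : R3 → ℂ) := by
  rw [integrable_indicator_iff measurableSet_ball]
  have : IsFiniteMeasure (volume.restrict (Metric.ball (0 : R3) A)) :=
    ⟨by rw [Measure.restrict_apply_univ]; exact measure_ball_lt_top⟩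
  exact ((Lp.memLp (𝓕 u)).restrict _).integrable (by norm_num)

theorem lowFreq_ae_eq (A : ℝ) (u : L2R3) : lowFreq A u =ᵐ[volume] lowFun A u := by
  rw [lowFun_eq_fourierInv]
  exact fourierInv_toLp_ae_eq (integrable_indicator_fourier A u) _

theorem continuous_lowFun (A : ℝ) (u : L2R3) : Continuous (lowFun A u) := by
  rw [lowFun_eq_fourierInv]
  exact fourierInv_continuous (integrable_indicator_fourier A u)

/-! ### The Gagliardo–Nirenberg inequality. -/

/-- The volume of the unit ball. -/
def unitVol : ℝ := volume.real (Metric.ball (0 : R3) 1)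

theorem unitVol_pos : 0 < unitVol :=
  ENNReal.toReal_pos (Metric.measure_ball_pos _ _ one_pos).ne' measure_ball_lt_top.ne

theorem volume_real_ball {A : ℝ} (hA : 0 ≤ A) :
    volume.real (Metric.ball (0 : R3) A) = A ^ 3 * unitVol := by
  rw [Measure.real, Measure.addHaar_ball _ _ hA]
  simp [unitVol, Measure.real, hA]

theorem norm_waveKernel_sq {A : ℝ} (hA : 0 ≤ A) (x : R3) :
    ‖waveKernel A x‖ ^ 2 = A ^ 3 * unitVol := by
  rw [← integral_norm_sq, ← volume_real_ball hA, ← integral_indicator_one measurableSet_ball]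
  refine integral_congr_ae ?_
  filter_upwards [(memLp_waveKernel A x).coeFn_toLp] with ξ h
  rw [waveKernel, h]
  by_cases hξ : ξ ∈ Metric.ball (0 : R3) A
  · rw [Set.indicator_of_mem hξ, Set.indicator_of_mem hξ, Circle.norm_coe]
    simp
  · simp [hξ]

/-- Bernstein's inequality, by Cauchy–Schwarz against the truncated plane wave. -/
theorem norm_lowFun_le {A : ℝ} (hA : 0 ≤ A) (u : L2R3) (x : R3) :
    ‖lowFun A u x‖ ≤ √(A ^ 3 * unitVol) * ‖u‖ := by
  rw [← norm_waveKernel_sq hA x, Real.sqrt_sq (norm_nonneg _)]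
  exact (norm_inner_le_norm _ _).trans_eq (by rw [Lp.norm_fourier_eq])

theorem lintegral_sub_lowFreq (A : ℝ) (u : L2R3) :
    ∫⁻ x, ENNReal.ofReal (‖(u - lowFreq A u : L2R3) x‖ ^ 2) =
      ∫⁻ ξ, (Metric.ball 0 A)ᶜ.indicator (fun ξ => ENNReal.ofReal (‖(𝓕 u : L2R3) ξ‖ ^ 2)) ξ := by
  rw [lintegral_norm_sq, ← Lp.norm_fourier_eq, ← lintegral_norm_sq]
  refine lintegral_congr_ae ?_
  filter_upwards [fourier_sub_lowFreq A u] with ξ h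
  rw [h]
  by_cases hξ : ξ ∈ (Metric.ball (0 : R3) A)ᶜ
  · rw [Set.indicator_of_mem hξ, Set.indicator_of_mem hξ]
  · rw [Set.indicator_of_notMem hξ, Set.indicator_of_notMem hξ]
    simp

/-- The set where `‖u‖` exceeds `t` is controlled by the high frequencies. -/
theorem meas_norm_gt_le {u : L2R3} (hu : u ≠ 0) {t : ℝ} (ht : 0 < t) :
    volume {x | t < ‖u x‖} ≤ ENNReal.ofReal (4 / t ^ 2) *
      ∫⁻ ξ, {ξ : R3 | t ≤ 2 * √unitVol * ‖u‖ * ‖ξ‖ ^ (3 / 2 : ℝ)}.indicator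
        (fun ξ => ENNReal.ofReal (‖(𝓕 u : L2R3) ξ‖ ^ 2)) ξ := by
  have hn : 0 < ‖u‖ := norm_pos_iff.2 hu
  have hω := unitVol_pos
  -- The cutoff A = B^{2/3} makes the Bernstein bound √(A³·unitVol)‖u‖ equal to t/2. Where |u| > t,
  -- the high-frequency part must then exceed t/2, and Chebyshev applies to it.
  set B : ℝ := t / (2 * √unitVol * ‖u‖) with hB
  have hBpos : 0 < B := by positivity
  set A : ℝ := B ^ (2 / 3 : ℝ) with hA
  have hApos : 0 < A := by positivity
  have hA3 : A ^ 3 = B ^ 2 := by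
    rw [hA, ← Real.rpow_natCast, ← Real.rpow_mul hBpos.le, ← Real.rpow_natCast]; norm_num
  have hlow : ∀ x, ‖lowFun A u x‖ ≤ t / 2 := by
    intro x
    refine (norm_lowFun_le hApos.le u x).trans_eq ?_
    rw [hA3, Real.sqrt_mul (by positivity), Real.sqrt_sq hBpos.le, hB]
    field_simp
  have hset : (Metric.ball (0 : R3) A)ᶜ =
      {ξ : R3 | t ≤ 2 * √unitVol * ‖u‖ * ‖ξ‖ ^ (3 / 2 : ℝ)} := by
    ext ξ
    simp only [Set.mem_compl_iff, mem_ball_zero_iff, not_lt, Set.mem_ofPred_eq]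
    have : B ≤ ‖ξ‖ ^ (3 / 2 : ℝ) ↔ t ≤ 2 * √unitVol * ‖u‖ * ‖ξ‖ ^ (3 / 2 : ℝ) := by
      rw [hB, div_le_iff₀' (by positivity)]
    rw [← this, hA]
    have h3 := Real.rpow_le_rpow_iff (x := B ^ (2 / 3 : ℝ)) (y := ‖ξ‖) (z := 3 / 2) (by positivity)
      (norm_nonneg _) (by norm_num)
    rw [← h3, ← Real.rpow_mul hBpos.le]
    norm_num
  rw [← hset, ← lintegral_sub_lowFreq]
  have hmeas : AEMeasurable (fun x => ENNReal.ofReal (‖(u - lowFreq A u : L2R3) x‖ ^ 2)) :=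
    (integrable_norm_sq _).1.aemeasurable.ennreal_ofReal
  have hcheb := mul_meas_ge_le_lintegral₀ hmeas (ENNReal.ofReal (t ^ 2 / 4))
  calc volume {x | t < ‖u x‖}
      ≤ volume {x | ENNReal.ofReal (t ^ 2 / 4)
          ≤ ENNReal.ofReal (‖(u - lowFreq A u : L2R3) x‖ ^ 2)} := by
        refine measure_mono_ae ?_
        filter_upwards [Lp.coeFn_sub u (lowFreq A u), lowFreq_ae_eq A u] with x h1 h2 (h3 : t < ‖u x‖)
        refine ENNReal.ofReal_le_ofReal ?_
        rw [h1, Pi.sub_apply, h2]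
        have h4 : t / 2 ≤ ‖u x - lowFun A u x‖ := by
          have := norm_sub_norm_le (u x) (lowFun A u x)
          have := hlow x
          linarith
        calc t ^ 2 / 4 = (t / 2) ^ 2 := by ring
          _ ≤ _ := by gcongr
    _ = ENNReal.ofReal (4 / t ^ 2) * (ENNReal.ofReal (t ^ 2 / 4) *
          volume {x | ENNReal.ofReal (t ^ 2 / 4)
          ≤ ENNReal.ofReal (‖(u - lowFreq A u : L2R3) x‖ ^ 2)}) := by
        rw [← mul_assoc, ← ENNReal.ofReal_mul (by positivity)]
        have : 4 / t ^ 2 * (t ^ 2 / 4) = 1 := by field_simp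
        rw [this]; simp
    _ ≤ _ := by gcongr

theorem lintegral_rpow_neg_third {L : ℝ} (hL : 0 ≤ L) :
    ∫⁻ t in Set.Ioc 0 L, ENNReal.ofReal (t ^ (-(1 / 3) : ℝ)) =
      ENNReal.ofReal (3 / 2 * L ^ (2 / 3 : ℝ)) := by
  rw [← ofReal_integral_eq_lintegral_ofReal]
  · rw [← intervalIntegral.integral_of_le hL, integral_rpow (Or.inl (by norm_num))]
    congr 1
    norm_num
    ring
  · have := (intervalIntegral.intervalIntegrable_rpow' (a := 0) (b := L) (r := -(1 / 3))
      (by norm_num))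
    rwa [intervalIntegrable_iff_integrableOn_Ioc_of_le hL] at this
  · filter_upwards [ae_restrict_mem measurableSet_Ioc] with t ht
    exact Real.rpow_nonneg ht.1.le _

/-- The constant of the Gagliardo–Nirenberg inequality below. -/
def gnConst : ℝ := 16 * (4 * unitVol) ^ (1 / 3 : ℝ)

theorem gnConst_pos : 0 < gnConst := by
  have := unitVol_pos
  unfold gnConst; positivity

/-- Gagliardo–Nirenberg inequality `‖u‖_{8/3}^{8/3} ≤ c ‖u‖_2^{2/3} ∫ |ξ| |û|²`. -/
theorem lintegral_rpow_le (u : L2R3) :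
    ∫⁻ x, ENNReal.ofReal (‖u x‖ ^ (8 / 3 : ℝ)) ≤
      ENNReal.ofReal (gnConst * ‖u‖ ^ (2 / 3 : ℝ)) *
        ∫⁻ ξ, ENNReal.ofReal (‖ξ‖ * ‖(𝓕 u : L2R3) ξ‖ ^ 2) := by
  by_cases hu : u = 0
  · subst hu
    have : ∫⁻ x, ENNReal.ofReal (‖(0 : L2R3) x‖ ^ (8 / 3 : ℝ)) = 0 := by
      rw [← lintegral_zero (μ := (volume : Measure R3))]
      refine lintegral_congr_ae ?_
      filter_upwards [Lp.coeFn_zero ℂ 2 (volume : Measure R3)] with x hx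
      rw [hx]; simp
    rw [this]; exact bot_le
  have hω := unitVol_pos
  -- L ξ is the largest level t for which ξ still counts as a high frequency: the cutoff moves with
  -- the level in the layer-cake formula.
  set L : R3 → ℝ := fun ξ => 2 * √unitVol * ‖u‖ * ‖ξ‖ ^ (3 / 2 : ℝ) with hL
  have hL0 : ∀ ξ, 0 ≤ L ξ := fun ξ => by positivity
  have hLm : Measurable L := by fun_prop
  set f : R3 → ENNReal := fun ξ => ENNReal.ofReal (‖(𝓕 u : L2R3) ξ‖ ^ 2) with hf
  have hfm : Measurable f := by
    have := (Lp.stronglyMeasurable (𝓕 u)).measurable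
    fun_prop
  rw [lintegral_rpow_eq_lintegral_meas_lt_mul volume (ae_of_all _ fun x => norm_nonneg _)
    (Lp.aestronglyMeasurable u).norm.aemeasurable (by norm_num)]
  have step : ∫⁻ t in Set.Ioi 0, volume {x | t < ‖u x‖} * ENNReal.ofReal (t ^ (8 / 3 - 1 : ℝ)) ≤
      ∫⁻ t in Set.Ioi (0 : ℝ), ∫⁻ ξ, ENNReal.ofReal 4 *
        (f ξ * (Set.Ioc 0 (L ξ)).indicator (fun t => ENNReal.ofReal (t ^ (-(1 / 3) : ℝ))) t) := by
    refine setLIntegral_mono' measurableSet_Ioi fun t ht => ?_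
    have ht : 0 < t := ht
    calc _ ≤ (ENNReal.ofReal (4 / t ^ 2) * ∫⁻ ξ, {ξ : R3 | t ≤ L ξ}.indicator f ξ) *
          ENNReal.ofReal (t ^ (8 / 3 - 1 : ℝ)) := by
          gcongr
          exact meas_norm_gt_le hu ht
      _ = ENNReal.ofReal (4 * t ^ (-(1 / 3) : ℝ)) * ∫⁻ ξ, {ξ : R3 | t ≤ L ξ}.indicator f ξ := by
          rw [mul_right_comm, ← ENNReal.ofReal_mul (by positivity)]
          congr 2
          rw [div_mul_eq_mul_div, mul_div_assoc, ← Real.rpow_natCast, ← Real.rpow_sub ht]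
          norm_num
      _ = _ := by
          rw [← lintegral_const_mul' _ _ ENNReal.ofReal_ne_top]
          refine lintegral_congr fun ξ => ?_
          by_cases h : t ≤ L ξ
          · rw [Set.indicator_of_mem (by exact h), Set.indicator_of_mem (by exact ⟨ht, h⟩),
              ENNReal.ofReal_mul (by norm_num)]
            ring
          · rw [Set.indicator_of_notMem (by exact h), Set.indicator_of_notMem (by exact fun h' => h h'.2)]
            simp
  -- After Tonelli, each ξ collects the levels 0 < t ≤ L ξ with weight t^{8/3−1−2} = t^{−1/3},
  -- giving L^{2/3}, which is proportional to |ξ|.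
  have hswap : ∫⁻ t in Set.Ioi (0 : ℝ), ∫⁻ ξ, ENNReal.ofReal 4 *
        (f ξ * (Set.Ioc 0 (L ξ)).indicator (fun t => ENNReal.ofReal (t ^ (-(1 / 3) : ℝ))) t) =
      ∫⁻ ξ, ENNReal.ofReal 4 * (f ξ * ENNReal.ofReal (3 / 2 * L ξ ^ (2 / 3 : ℝ))) := by
    rw [lintegral_lintegral_swap]
    · refine lintegral_congr fun ξ => ?_
      rw [lintegral_const_mul' _ _ ENNReal.ofReal_ne_top,
        lintegral_const_mul' _ _ ENNReal.ofReal_ne_top, lintegral_indicator measurableSet_Ioc,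
        Measure.restrict_restrict measurableSet_Ioc,
        Set.inter_eq_left.2 (fun t ht => ht.1), lintegral_rpow_neg_third (hL0 ξ)]
    · refine Measurable.aemeasurable ?_
      refine Measurable.const_mul ?_ _
      refine (hfm.comp measurable_snd).mul ?_
      have hs : MeasurableSet {p : ℝ × R3 | p.1 ∈ Set.Ioc 0 (L p.2)} :=
        (measurableSet_lt measurable_const measurable_fst).inter
          (measurableSet_le measurable_fst (hLm.comp measurable_snd))
      have : (fun p : ℝ × R3 => (Set.Ioc 0 (L p.2)).indicator
          (fun t => ENNReal.ofReal (t ^ (-(1 / 3) : ℝ))) p.1) =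
          {p : ℝ × R3 | p.1 ∈ Set.Ioc 0 (L p.2)}.indicator
            (fun p => ENNReal.ofReal (p.1 ^ (-(1 / 3) : ℝ))) := by
        ext p
        simp only [Set.indicator, Set.mem_ofPred_eq]
      change Measurable (fun p : ℝ × R3 => (Set.Ioc 0 (L p.2)).indicator
          (fun t => ENNReal.ofReal (t ^ (-(1 / 3) : ℝ))) p.1)
      rw [this]
      refine Measurable.indicator ?_ hs
      fun_prop
  refine (mul_le_mul_right (step.trans_eq hswap) _).trans_eq ?_
  rw [← lintegral_const_mul' _ _ ENNReal.ofReal_ne_top,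
    ← lintegral_const_mul' _ _ ENNReal.ofReal_ne_top]
  refine lintegral_congr fun ξ => ?_
  have h0 := hL0 ξ
  rw [hf]
  simp only []
  rw [← ENNReal.ofReal_mul (by positivity), ← ENNReal.ofReal_mul (by positivity),
    ← ENNReal.ofReal_mul (by positivity), ← ENNReal.ofReal_mul (by unfold gnConst; positivity)]
  congr 1
  have : L ξ ^ (2 / 3 : ℝ) = (4 * unitVol) ^ (1 / 3 : ℝ) * ‖u‖ ^ (2 / 3 : ℝ) * ‖ξ‖ := by
    rw [hL]
    simp only []
    rw [Real.mul_rpow (by positivity) (by positivity), ← Real.rpow_mul (norm_nonneg _),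
      Real.mul_rpow (by positivity) (by positivity)]
    have : (2 * √unitVol) = (4 * unitVol) ^ (1 / 2 : ℝ) := by
      rw [← Real.sqrt_eq_rpow, Real.sqrt_mul (by norm_num), show (4 : ℝ) = 2 ^ 2 by norm_num,
        Real.sqrt_sq (by norm_num)]
    rw [this, ← Real.rpow_mul (by positivity)]
    norm_num
  -- 16 = (8/3)·4·(3/2): the factors of the layer-cake formula, of Chebyshev at height t/2, and of
  -- the integral in t.
  rw [this, gnConst]
  ring

/-! ### Elementary properties of the Sobolev norm and the exchange energy. -/

theorem fourier_sub (u v : L2R3) : 𝓕 (u - v) = 𝓕 u - 𝓕 v :=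
  (Lp.fourierTransformₗᵢ R3 ℂ).map_sub u v

theorem sobolevDensity_nonneg (s : ℝ) (u : L2R3) (ξ : R3) : 0 ≤ sobolevDensity s u ξ := by
  unfold sobolevDensity; positivity

theorem sobolevNormSq_nonneg (s : ℝ) (u : L2R3) : 0 ≤ sobolevNormSq s u :=
  integral_nonneg (sobolevDensity_nonneg s u)

theorem measurable_sobolevDensity (s : ℝ) (u : L2R3) : Measurable (sobolevDensity s u) := by
  have := (Lp.stronglyMeasurable (𝓕 u)).measurable
  unfold sobolevDensity
  fun_prop

theorem one_le_japanese (ξ : R3) : 1 ≤ (1 + ‖ξ‖ ^ 2) ^ (1 / 2 : ℝ) :=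
  Real.one_le_rpow (by nlinarith [sq_nonneg ‖ξ‖]) (by norm_num)

theorem norm_le_japanese (ξ : R3) : ‖ξ‖ ≤ (1 + ‖ξ‖ ^ 2) ^ (1 / 2 : ℝ) := by
  rw [← Real.sqrt_eq_rpow]
  exact Real.le_sqrt_of_sq_le (by linarith)

theorem norm_sq_le_sobolevNormSq {u : L2R3} (hu : u ∈ Hhalf) :
    ‖u‖ ^ 2 ≤ sobolevNormSq (1 / 2) u := by
  rw [← Lp.norm_fourier_eq, ← integral_norm_sq]
  refine integral_mono (integrable_norm_sq _) hu fun ξ => ?_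
  exact le_mul_of_one_le_left (by positivity) (one_le_japanese ξ)

theorem integrable_norm_mul_fourier {u : L2R3} (hu : u ∈ Hhalf) :
    Integrable fun ξ => ‖ξ‖ * ‖(𝓕 u : L2R3) ξ‖ ^ 2 := by
  have hm := (Lp.stronglyMeasurable (𝓕 u)).measurable
  refine Integrable.mono' hu (by fun_prop) (ae_of_all _ fun ξ => ?_)
  rw [Real.norm_of_nonneg (by positivity)]
  exact mul_le_mul_of_nonneg_right (norm_le_japanese ξ) (by positivity)

theorem integral_norm_mul_fourier_le {u : L2R3} (hu : u ∈ Hhalf) :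
    ∫ ξ, ‖ξ‖ * ‖(𝓕 u : L2R3) ξ‖ ^ 2 ≤ sobolevNormSq (1 / 2) u :=
  integral_mono (integrable_norm_mul_fourier hu) hu fun ξ =>
    mul_le_mul_of_nonneg_right (norm_le_japanese ξ) (by positivity)

theorem integrable_lpPow {u : L2R3} (hu : u ∈ Hhalf) :
    Integrable fun x => ‖u x‖ ^ (8 / 3 : ℝ) := by
  have hm := (Lp.stronglyMeasurable u).measurable
  refine ⟨Measurable.aestronglyMeasurable (by fun_prop), ?_⟩
  rw [hasFiniteIntegral_iff_ofReal (ae_of_all _ fun x => by positivity)]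
  refine (lintegral_rpow_le u).trans_lt ?_
  exact ENNReal.mul_lt_top ENNReal.ofReal_lt_top
    ((hasFiniteIntegral_iff_ofReal (ae_of_all _ fun x => by positivity)).1
      (integrable_norm_mul_fourier hu).2)

theorem lpPow_nonneg (p : ℝ) (u : L2R3) : 0 ≤ lpPow p u :=
  integral_nonneg fun x => by positivity

/-- Gagliardo–Nirenberg inequality in `H^{1/2}`. -/
theorem lpPow_le {u : L2R3} (hu : u ∈ Hhalf) :
    lpPow (8 / 3) u ≤ gnConst * ‖u‖ ^ (2 / 3 : ℝ) * sobolevNormSq (1 / 2) u := by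
  have hc := gnConst_pos
  refine le_trans ?_ (mul_le_mul_of_nonneg_left (integral_norm_mul_fourier_le hu) (by positivity))
  have h := lintegral_rpow_le u
  rw [← ofReal_integral_eq_lintegral_ofReal (integrable_lpPow hu)
      (ae_of_all _ fun x => by positivity),
    ← ofReal_integral_eq_lintegral_ofReal (integrable_norm_mul_fourier hu)
      (ae_of_all _ fun x => by positivity), ← ENNReal.ofReal_mul (by positivity)] at h
  refine (ENNReal.ofReal_le_ofReal_iff ?_).1 h
  exact mul_nonneg (by positivity) (integral_nonneg fun x => by positivity)

theorem sobolevDensity_sub_le (s : ℝ) (u v : L2R3) :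
    ∀ᵐ ξ, sobolevDensity s (u - v) ξ ≤ 2 * (sobolevDensity s u ξ + sobolevDensity s v ξ) := by
  rw [show sobolevDensity s (u - v) = fun ξ =>
    (1 + ‖ξ‖ ^ 2) ^ s * ‖(𝓕 u - 𝓕 v : L2R3) ξ‖ ^ 2 by
      ext ξ; rw [sobolevDensity, fourier_sub]]
  filter_upwards [Lp.coeFn_sub (𝓕 u) (𝓕 v)] with ξ h
  rw [h, Pi.sub_apply]
  unfold sobolevDensity
  rw [← mul_add, mul_left_comm]
  refine mul_le_mul_of_nonneg_left ?_ (by positivity)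
  have h1 := norm_sub_le ((𝓕 u : L2R3) ξ) ((𝓕 v : L2R3) ξ)
  nlinarith [norm_nonneg ((𝓕 u : L2R3) ξ - (𝓕 v : L2R3) ξ),
    sq_nonneg (‖(𝓕 u : L2R3) ξ‖ - ‖(𝓕 v : L2R3) ξ‖)]

theorem Hhalf_sub {u v : L2R3} (hu : u ∈ Hhalf) (hv : v ∈ Hhalf) : u - v ∈ Hhalf := by
  refine Integrable.mono' ((Integrable.add hu hv).const_mul 2)
    (measurable_sobolevDensity _ _).aestronglyMeasurable ?_
  filter_upwards [sobolevDensity_sub_le (1 / 2) u v] with ξ h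
  rw [Real.norm_of_nonneg (sobolevDensity_nonneg _ _ _)]
  exact h

theorem sobolevDensity_smul (s : ℝ) (c : ℂ) (u : L2R3) :
    sobolevDensity s (c • u) =ᵐ[volume] fun ξ => ‖c‖ ^ 2 * sobolevDensity s u ξ := by
  have : 𝓕 (c • u) = c • 𝓕 u := (Lp.fourierTransformₗᵢ R3 ℂ).map_smul c u
  filter_upwards [Lp.coeFn_smul c (𝓕 u)] with ξ h
  rw [sobolevDensity, this, h, sobolevDensity, Pi.smul_apply, norm_smul]
  ring

theorem Hhalf_smul (c : ℂ) {u : L2R3} (hu : u ∈ Hhalf) : c • u ∈ Hhalf :=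
  (Integrable.const_mul hu _).congr (sobolevDensity_smul _ c u).symm

theorem sobolevNormSq_smul (s : ℝ) (c : ℂ) (u : L2R3) :
    sobolevNormSq s (c • u) = ‖c‖ ^ 2 * sobolevNormSq s u := by
  rw [sobolevNormSq, integral_congr_ae (sobolevDensity_smul s c u), integral_const_mul]
  rfl

theorem lpPow_smul (p : ℝ) (c : ℂ) (u : L2R3) : lpPow p (c • u) = ‖c‖ ^ p * lpPow p u := by
  rw [lpPow, lpPow, ← integral_const_mul]
  refine integral_congr_ae ?_
  filter_upwards [Lp.coeFn_smul c u] with x h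
  rw [h, Pi.smul_apply, norm_smul, Real.mul_rpow (norm_nonneg _) (norm_nonneg _)]

/-! ### High frequencies -/

theorem sobolevDensity_high (s A : ℝ) (u : L2R3) :
    sobolevDensity s (u - lowFreq A u) =ᵐ[volume]
      (Metric.ball 0 A)ᶜ.indicator (sobolevDensity s u) := by
  filter_upwards [fourier_sub_lowFreq A u] with ξ h
  rw [sobolevDensity, h]
  by_cases hξ : ξ ∈ (Metric.ball (0 : R3) A)ᶜ
  · rw [Set.indicator_of_mem hξ, Set.indicator_of_mem hξ, sobolevDensity]
  · rw [Set.indicator_of_notMem hξ, Set.indicator_of_notMem hξ]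
    simp

theorem Hhalf_high (A : ℝ) {u : L2R3} (hu : u ∈ Hhalf) : u - lowFreq A u ∈ Hhalf :=
  (Integrable.indicator hu measurableSet_ball.compl).congr (sobolevDensity_high _ A u).symm

theorem sobolevNormSq_high_le (A : ℝ) {u : L2R3} (hu : u ∈ Hhalf) :
    sobolevNormSq (1 / 2) (u - lowFreq A u) ≤ sobolevNormSq (1 / 2) u := by
  rw [sobolevNormSq, integral_congr_ae (sobolevDensity_high _ A u)]
  refine integral_mono (Integrable.indicator hu measurableSet_ball.compl) hu fun ξ => ?_
  exact Set.indicator_le_self' (fun _ _ => sobolevDensity_nonneg _ _ _) ξ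

theorem norm_sq_high_le {A : ℝ} (hA : 0 < A) {u : L2R3} (hu : u ∈ Hhalf) :
    ‖u - lowFreq A u‖ ^ 2 ≤ sobolevNormSq (1 / 2) u / A := by
  rw [← Lp.norm_fourier_eq, ← integral_norm_sq, le_div_iff₀ hA, ← integral_mul_const]
  refine integral_mono_ae ((integrable_norm_sq _).mul_const _) hu ?_
  filter_upwards [fourier_sub_lowFreq A u] with ξ h
  rw [h, sobolevDensity]
  by_cases hξ : ξ ∈ (Metric.ball (0 : R3) A)ᶜ
  · rw [Set.indicator_of_mem hξ, mul_comm]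
    refine mul_le_mul_of_nonneg_right (le_trans ?_ (norm_le_japanese ξ)) (by positivity)
    simpa using hξ
  · rw [Set.indicator_of_notMem hξ]
    simp only [norm_zero]
    rw [zero_pow two_ne_zero, zero_mul]
    positivity

/-- Gagliardo–Nirenberg for the high-frequency part; the decay in A comes from its small L² norm. -/
theorem lpPow_high_le {A : ℝ} (hA : 0 < A) {u : L2R3} (hu : u ∈ Hhalf) :
    lpPow (8 / 3) (u - lowFreq A u) ≤
      gnConst * (sobolevNormSq (1 / 2) u / A) ^ (1 / 3 : ℝ) * sobolevNormSq (1 / 2) u := by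
  have hc := gnConst_pos
  have hK := sobolevNormSq_nonneg (1 / 2) u
  refine (lpPow_le (Hhalf_high A hu)).trans ?_
  have h1 : ‖u - lowFreq A u‖ ^ (2 / 3 : ℝ) ≤ (sobolevNormSq (1 / 2) u / A) ^ (1 / 3 : ℝ) := by
    have := Real.rpow_le_rpow (by positivity) (norm_sq_high_le hA hu) (z := 1 / 3) (by norm_num)
    rw [← Real.rpow_natCast, ← Real.rpow_mul (norm_nonneg _)] at this
    norm_num at this ⊢
    exact this
  have h2 := sobolevNormSq_high_le A hu
  have h3 := sobolevNormSq_nonneg (1 / 2) (u - lowFreq A u)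
  gcongr

/-! ### The Coulomb energy -/

theorem coulomb_nonneg (u : L2R3) : 0 ≤ coulomb u :=
  integral_nonneg fun z => by positivity

/-- The Coulomb energy with the kernel truncated near the diagonal. -/
def coulombTrunc (R : ℝ) (u : L2R3) : ℝ :=
  ∫ z : R3 × R3, ‖u z.1‖ ^ 2 * ‖u z.2‖ ^ 2 / max R ‖z.1 - z.2‖

theorem integrable_mul_trunc {R : ℝ} (hR : 0 < R) {f g : R3 → ℝ} (hf : Integrable f)
    (hg : Integrable g) :
    Integrable fun z : R3 × R3 => f z.1 * g z.2 / max R ‖z.1 - z.2‖ := by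
  have h := (hf.mul_prod hg).mul_const R⁻¹
  have hm : Measurable fun z : R3 × R3 => (max R ‖z.1 - z.2‖)⁻¹ := by fun_prop
  refine h.mono (by simp only [div_eq_mul_inv]; exact (hf.mul_prod hg).1.mul hm.aestronglyMeasurable)
    (ae_of_all _ fun z => ?_)
  have : 0 < max R ‖z.1 - z.2‖ := lt_max_of_lt_left hR
  rw [norm_div, norm_mul _ R⁻¹, div_eq_mul_inv, Real.norm_of_nonneg this.le,
    Real.norm_of_nonneg (inv_pos.2 hR).le]
  gcongr
  exact le_max_left _ _

/-- The truncated kernel is at most 1/R, so the truncated energy sees the densities only through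
their L¹ norms. This is what makes it stable under the L¹ convergence supplied by Brezis–Lieb. -/
theorem integral_mul_trunc_le {R : ℝ} (hR : 0 < R) {f g : R3 → ℝ} (hf : Integrable f)
    (hg : Integrable g) (hf0 : ∀ x, 0 ≤ f x) (hg0 : ∀ x, 0 ≤ g x) :
    ∫ z : R3 × R3, f z.1 * g z.2 / max R ‖z.1 - z.2‖ ≤ (∫ x, f x) * (∫ x, g x) / R := by
  rw [← integral_prod_mul, ← integral_div]
  refine integral_mono (integrable_mul_trunc hR hf hg) ((hf.mul_prod hg).div_const R) fun z => ?_
  have : 0 < max R ‖z.1 - z.2‖ := lt_max_of_lt_left hR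
  exact div_le_div_of_nonneg_left (mul_nonneg (hf0 _) (hg0 _)) hR (le_max_left _ _)

theorem coulombTrunc_le {R : ℝ} (hR : 0 < R) (u : L2R3) :
    coulombTrunc R u ≤ (‖u‖ ^ 2) ^ 2 / R := by
  have := integral_mul_trunc_le hR (integrable_norm_sq u) (integrable_norm_sq u)
    (fun x => by positivity) fun x => by positivity
  rwa [integral_norm_sq, ← sq] at this

theorem integral_add_le_integral_add {X : Type*} [MeasurableSpace X] {μ : Measure X}
    {a b c d e : X → ℝ} (ha : Integrable a μ) (hb : Integrable b μ) (hc : Integrable c μ)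
    (hd : Integrable d μ) (he : Integrable e μ) (h : ∀ x, a x + b x ≤ c x + (d x + e x)) :
    ∫ x, a x ∂μ + ∫ x, b x ∂μ ≤ ∫ x, c x ∂μ + (∫ x, d x ∂μ + ∫ x, e x ∂μ) := by
  have h1 := integral_mono (ha.add hb) (hc.add (hd.add he)) h
  rwa [integral_add' ha hb, integral_add' hc (hd.add he), integral_add' hd he] at h1

/-- Superadditivity of the truncated Coulomb energy up to the `L¹` defect of the densities. -/
theorem coulombTrunc_add_le {R : ℝ} (hR : 0 < R) (u v r : L2R3) :
    coulombTrunc R v + coulombTrunc R r ≤ coulombTrunc R u +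
      (∫ x, |‖u x‖ ^ 2 - ‖r x‖ ^ 2 - ‖v x‖ ^ 2|) * (‖u‖ ^ 2 + ‖r‖ ^ 2 + ‖v‖ ^ 2) / R := by
  have hu := integrable_norm_sq u
  have hv := integrable_norm_sq v
  have hr := integrable_norm_sq r
  have he : Integrable fun x => |‖u x‖ ^ 2 - ‖r x‖ ^ 2 - ‖v x‖ ^ 2| := ((hu.sub hr).sub hv).abs
  have hrv : Integrable fun x => ‖r x‖ ^ 2 + ‖v x‖ ^ 2 := hr.add hv
  have h1 := integral_mul_trunc_le hR he hu (fun x => abs_nonneg _) fun x => by positivity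
  have h2 := integral_mul_trunc_le hR hrv he (fun x => by positivity) fun x => abs_nonneg _
  have h3 : (∫ x, (‖r x‖ ^ 2 + ‖v x‖ ^ 2)) = ‖r‖ ^ 2 + ‖v‖ ^ 2 := by
    rw [integral_add hr hv, integral_norm_sq, integral_norm_sq]
  rw [integral_norm_sq] at h1
  rw [h3] at h2
  have h4 : coulombTrunc R v + coulombTrunc R r ≤ coulombTrunc R u +
      ((∫ z : R3 × R3, |‖u z.1‖ ^ 2 - ‖r z.1‖ ^ 2 - ‖v z.1‖ ^ 2| * ‖u z.2‖ ^ 2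
          / max R ‖z.1 - z.2‖) +
        ∫ z : R3 × R3, (‖r z.1‖ ^ 2 + ‖v z.1‖ ^ 2) * |‖u z.2‖ ^ 2 - ‖r z.2‖ ^ 2 - ‖v z.2‖ ^ 2|
          / max R ‖z.1 - z.2‖) := by
    refine integral_add_le_integral_add (integrable_mul_trunc hR hv hv)
      (integrable_mul_trunc hR hr hr) (integrable_mul_trunc hR hu hu)
      (integrable_mul_trunc hR he hu) (integrable_mul_trunc hR hrv he) fun z => ?_
    simp only [← add_div]
    have : 0 < max R ‖z.1 - z.2‖ := lt_max_of_lt_left hR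
    refine div_le_div_of_nonneg_right ?_ this.le
    -- With a = |u|², b = |r|² + |v|² and e = a − b, one has a₁a₂ = b₁b₂ + b₁e₂ + e₁a₂, and b₁b₂
    -- dominates |r₁|²|r₂|² + |v₁|²|v₂|² once the nonnegative cross terms are dropped.
    have e1 := neg_abs_le (‖u z.1‖ ^ 2 - ‖r z.1‖ ^ 2 - ‖v z.1‖ ^ 2)
    have e2 := neg_abs_le (‖u z.2‖ ^ 2 - ‖r z.2‖ ^ 2 - ‖v z.2‖ ^ 2)
    have p1 := mul_le_mul_of_nonneg_right e1 (sq_nonneg ‖u z.2‖)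
    have p2 := mul_le_mul_of_nonneg_left e2 (add_nonneg (sq_nonneg ‖r z.1‖) (sq_nonneg ‖v z.1‖))
    have p3 := mul_nonneg (sq_nonneg ‖r z.1‖) (sq_nonneg ‖v z.2‖)
    have p4 := mul_nonneg (sq_nonneg ‖v z.1‖) (sq_nonneg ‖r z.2‖)
    nlinarith
  refine h4.trans (add_le_add le_rfl ((add_le_add h1 h2).trans_eq ?_))
  ring

theorem lintegral_ball_norm_inv_sq {R : ℝ} (hR : 0 < R) :
    ∫⁻ x : R3, (Metric.ball 0 R).indicator (fun x => ENNReal.ofReal ((‖x‖⁻¹) ^ 2)) x =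
      ENNReal.ofReal (3 * unitVol * R) := by
  set g : ℝ → ℝ := (Set.Iio R).indicator fun y => (y⁻¹) ^ 2 with hg
  have h1 : ∀ x : R3, (Metric.ball 0 R).indicator (fun x => ENNReal.ofReal ((‖x‖⁻¹) ^ 2)) x
      = ENNReal.ofReal (g ‖x‖) := by
    intro x
    by_cases hx : ‖x‖ < R
    · rw [Set.indicator_of_mem (by simpa using hx), hg, Set.indicator_of_mem (by simpa using hx)]
    · rw [Set.indicator_of_notMem (by simpa using hx), hg,
        Set.indicator_of_notMem (by simpa using hx)]
      simp
  -- In polar coordinates the Jacobian y² cancels the singularity exactly, leaving the length R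
  -- times the sphere area 3·unitVol.
  have h2 : Set.EqOn (fun y : ℝ => y ^ (Module.finrank ℝ R3 - 1) • g y)
      ((Set.Iio R).indicator fun _ => 1) (Set.Ioi 0) := by
    intro y hy
    have hy : y ≠ 0 := (show (0 : ℝ) < y from hy).ne'
    by_cases hyR : y < R
    · simp only [hg]
      rw [Set.indicator_of_mem (by exact hyR), Set.indicator_of_mem (by exact hyR)]
      simp
      field_simp
    · simp only [hg]
      rw [Set.indicator_of_notMem (by exact hyR), Set.indicator_of_notMem (by exact hyR)]
      simp
  have hint : IntegrableOn ((Set.Iio R).indicator fun _ : ℝ => (1 : ℝ)) (Set.Ioi 0) := by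
    rw [IntegrableOn, integrable_indicator_iff measurableSet_Iio, IntegrableOn,
      Measure.restrict_restrict measurableSet_Iio, Set.Iio_inter_Ioi]
    exact integrable_const _
  have hgi : Integrable fun x : R3 => g ‖x‖ := by
    rw [integrable_fun_norm_addHaar]
    exact hint.congr_fun h2.symm measurableSet_Ioi
  rw [lintegral_congr h1, ← ofReal_integral_eq_lintegral_ofReal hgi
    (ae_of_all _ fun x => Set.indicator_nonneg (fun y _ => by positivity) _),
    integral_fun_norm_addHaar, setIntegral_congr_fun measurableSet_Ioi h2,
    integral_indicator measurableSet_Iio, Measure.restrict_restrict measurableSet_Iio,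
    Set.Iio_inter_Ioi]
  congr 1
  simp [unitVol, hR.le]
  ring

/-- With s = a^{2/3} and r = b^{2/3} the left side is (s²r²)(srk): Young's inequality with parameter
t, then s²r² ≤ (s⁴ + r⁴)/2. For k = |x−y|⁻¹ near the diagonal, every resulting term is controlled by
the 8/3-power integral, because k² is integrable on balls of ℝ³. -/
theorem sq_mul_sq_mul_le {a b k t : ℝ} (ha : 0 ≤ a) (hb : 0 ≤ b) (ht : 0 < t) :
    a ^ 2 * b ^ 2 * k ≤ t / 2 * (a ^ (8 / 3 : ℝ) * b ^ (8 / 3 : ℝ)) +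
      1 / (4 * t) * (a ^ (8 / 3 : ℝ) * k ^ 2 + b ^ (8 / 3 : ℝ) * k ^ 2) := by
  obtain ⟨s, hs0, hs⟩ : ∃ s : ℝ, 0 ≤ s ∧ s = a ^ (2 / 3 : ℝ) := ⟨_, by positivity, rfl⟩
  obtain ⟨r, hr0, hr⟩ : ∃ r : ℝ, 0 ≤ r ∧ r = b ^ (2 / 3 : ℝ) := ⟨_, by positivity, rfl⟩
  have e1 : a ^ 2 = s ^ 3 := by
    rw [hs, ← Real.rpow_natCast, ← Real.rpow_natCast, ← Real.rpow_mul ha]; norm_num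
  have e2 : b ^ 2 = r ^ 3 := by
    rw [hr, ← Real.rpow_natCast, ← Real.rpow_natCast, ← Real.rpow_mul hb]; norm_num
  have e3 : a ^ (8 / 3 : ℝ) = s ^ 4 := by
    rw [hs, ← Real.rpow_natCast, ← Real.rpow_mul ha]; norm_num
  have e4 : b ^ (8 / 3 : ℝ) = r ^ 4 := by
    rw [hr, ← Real.rpow_natCast, ← Real.rpow_mul hb]; norm_num
  rw [e1, e2, e3, e4]
  have h1 : s ^ 3 * r ^ 3 * k ≤ t / 2 * (s ^ 4 * r ^ 4) + 1 / (2 * t) * (s ^ 2 * r ^ 2 * k ^ 2) := by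
    have := mul_nonneg (by positivity : (0 : ℝ) ≤ 1 / (2 * t))
      (sq_nonneg (t * (s ^ 2 * r ^ 2) - s * r * k))
    have e : 1 / (2 * t) * (t * (s ^ 2 * r ^ 2) - s * r * k) ^ 2 =
      t / 2 * (s ^ 4 * r ^ 4) + 1 / (2 * t) * (s ^ 2 * r ^ 2 * k ^ 2) - s ^ 3 * r ^ 3 * k := by
      field_simp; ring
    linarith
  have h2 := mul_nonneg (by positivity : (0 : ℝ) ≤ 1 / (4 * t))
    (mul_nonneg (sq_nonneg (s ^ 2 - r ^ 2)) (sq_nonneg k))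
  have e : 1 / (4 * t) * ((s ^ 2 - r ^ 2) ^ 2 * k ^ 2) =
      1 / (4 * t) * (s ^ 4 * k ^ 2 + r ^ 4 * k ^ 2) - 1 / (2 * t) * (s ^ 2 * r ^ 2 * k ^ 2) := by
    field_simp; ring
  linarith

/-- The part of the Coulomb energy near the diagonal. -/
theorem lintegral_near_le {u : L2R3} (hu : Integrable fun x => ‖u x‖ ^ (8 / 3 : ℝ)) {R t : ℝ}
    (hR : 0 < R) (ht : 0 < t) :
    ∫⁻ z : R3 × R3, ENNReal.ofReal (‖u z.1‖ ^ 2 * ‖u z.2‖ ^ 2 *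
        (Metric.ball (0 : R3) R).indicator (fun x => ‖x‖⁻¹) (z.1 - z.2)) ≤
      ENNReal.ofReal (t / 2 * lpPow (8 / 3) u ^ 2 +
        3 * unitVol * R / (2 * t) * lpPow (8 / 3) u) := by
  have hum := (Lp.stronglyMeasurable u).measurable
  have hω := unitVol_pos
  have hP := lpPow_nonneg (8 / 3) u
  set F : R3 → ENNReal := fun x => ENNReal.ofReal (‖u x‖ ^ (8 / 3 : ℝ)) with hF
  set G : R3 → ENNReal :=
    (Metric.ball 0 R).indicator (fun x => ENNReal.ofReal ((‖x‖⁻¹) ^ 2)) with hG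
  have hFm : Measurable F := by fun_prop
  have hGm : Measurable G := Measurable.indicator (by fun_prop) measurableSet_ball
  have hFi : ∫⁻ x, F x = ENNReal.ofReal (lpPow (8 / 3) u) :=
    (ofReal_integral_eq_lintegral_ofReal hu (ae_of_all _ fun x => by positivity)).symm
  have hGi : ∫⁻ x, G x = ENNReal.ofReal (3 * unitVol * R) := lintegral_ball_norm_inv_sq hR
  have hGn : ∀ z : R3 × R3, G (z.1 - z.2) =
      ENNReal.ofReal ((Metric.ball (0 : R3) R).indicator (fun x => ‖x‖⁻¹) (z.1 - z.2) ^ 2) := by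
    intro z
    by_cases h : z.1 - z.2 ∈ Metric.ball (0 : R3) R
    · rw [hG, Set.indicator_of_mem h, Set.indicator_of_mem h]
    · rw [hG, Set.indicator_of_notMem h, Set.indicator_of_notMem h]; simp
  have hpt : ∀ z : R3 × R3, ENNReal.ofReal (‖u z.1‖ ^ 2 * ‖u z.2‖ ^ 2 *
        (Metric.ball (0 : R3) R).indicator (fun x => ‖x‖⁻¹) (z.1 - z.2)) ≤
      ENNReal.ofReal (t / 2) * (F z.1 * F z.2) + ENNReal.ofReal (1 / (4 * t)) *
        (F z.1 * G (z.1 - z.2) + F z.2 * G (z.1 - z.2)) := by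
    intro z
    rw [hGn, hF]
    simp only []
    rw [← ENNReal.ofReal_mul (by positivity), ← ENNReal.ofReal_mul (by positivity),
      ← ENNReal.ofReal_mul (by positivity), ← ENNReal.ofReal_mul (by positivity),
      ← ENNReal.ofReal_add (by positivity) (by positivity), ← ENNReal.ofReal_mul (by positivity),
      ← ENNReal.ofReal_add (by positivity) (by positivity)]
    exact ENNReal.ofReal_le_ofReal (sq_mul_sq_mul_le (norm_nonneg _) (norm_nonneg _) ht)
  have hm1 : Measurable fun z : R3 × R3 => F z.1 * G (z.1 - z.2) :=
    (hFm.comp measurable_fst).mul (hGm.comp (measurable_fst.sub measurable_snd))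
  have hm2 : Measurable fun z : R3 × R3 => F z.2 * G (z.1 - z.2) :=
    (hFm.comp measurable_snd).mul (hGm.comp (measurable_fst.sub measurable_snd))
  have i1 : ∫⁻ z : R3 × R3, F z.1 * F z.2 = ENNReal.ofReal (lpPow (8 / 3) u ^ 2) := by
    rw [Measure.volume_eq_prod, lintegral_prod_mul hFm.aemeasurable hFm.aemeasurable, hFi,
      ← ENNReal.ofReal_mul hP, sq]
  have i2 : ∫⁻ z : R3 × R3, F z.1 * G (z.1 - z.2) =
      ENNReal.ofReal (lpPow (8 / 3) u * (3 * unitVol * R)) := by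
    rw [Measure.volume_eq_prod, lintegral_prod _ hm1.aemeasurable]
    simp only []
    have : ∀ x, ∫⁻ y, F x * G (x - y) = F x * ENNReal.ofReal (3 * unitVol * R) := by
      intro x
      rw [lintegral_const_mul' _ _ ENNReal.ofReal_ne_top, lintegral_sub_left_eq_self, hGi]
    simp_rw [this]
    rw [lintegral_mul_const' _ _ ENNReal.ofReal_ne_top, hFi, ENNReal.ofReal_mul hP]
  have i3 : ∫⁻ z : R3 × R3, F z.2 * G (z.1 - z.2) =
      ENNReal.ofReal (lpPow (8 / 3) u * (3 * unitVol * R)) := by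
    rw [Measure.volume_eq_prod, lintegral_prod_symm _ hm2.aemeasurable]
    simp only []
    have : ∀ y, ∫⁻ x, F y * G (x - y) = F y * ENNReal.ofReal (3 * unitVol * R) := by
      intro y
      rw [lintegral_const_mul' _ _ ENNReal.ofReal_ne_top, lintegral_sub_right_eq_self, hGi]
    simp_rw [this]
    rw [lintegral_mul_const' _ _ ENNReal.ofReal_ne_top, hFi, ENNReal.ofReal_mul hP]
  refine (lintegral_mono hpt).trans_eq ?_
  have hm0 : Measurable fun z : R3 × R3 => ENNReal.ofReal (t / 2) * (F z.1 * F z.2) :=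
    ((hFm.comp measurable_fst).mul (hFm.comp measurable_snd)).const_mul _
  rw [lintegral_add_left hm0, lintegral_const_mul' _ _ ENNReal.ofReal_ne_top,
    lintegral_const_mul' _ _ ENNReal.ofReal_ne_top, lintegral_add_right _ hm2, i1, i2, i3,
    ← ENNReal.ofReal_add (by positivity) (by positivity), ← ENNReal.ofReal_mul (by positivity),
    ← ENNReal.ofReal_mul (by positivity), ← ENNReal.ofReal_add (by positivity) (by positivity)]
  congr 1
  field_simp
  ring

theorem coulomb_integrand_le {R : ℝ} (hR : 0 < R) (u : L2R3) (z : R3 × R3) :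
    ‖u z.1‖ ^ 2 * ‖u z.2‖ ^ 2 / ‖z.1 - z.2‖ ≤
      ‖u z.1‖ ^ 2 * ‖u z.2‖ ^ 2 *
        (Metric.ball (0 : R3) R).indicator (fun x => ‖x‖⁻¹) (z.1 - z.2) +
      ‖u z.1‖ ^ 2 * ‖u z.2‖ ^ 2 / max R ‖z.1 - z.2‖ := by
  by_cases h : z.1 - z.2 ∈ Metric.ball (0 : R3) R
  · rw [Set.indicator_of_mem h, ← div_eq_mul_inv]
    have : 0 < max R ‖z.1 - z.2‖ := lt_max_of_lt_left hR
    have : 0 ≤ ‖u z.1‖ ^ 2 * ‖u z.2‖ ^ 2 / max R ‖z.1 - z.2‖ := by positivity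
    linarith
  · rw [Set.indicator_of_notMem h, mul_zero, zero_add]
    have : R ≤ ‖z.1 - z.2‖ := by simpa using h
    rw [max_eq_right this]

theorem integrable_near {u : L2R3} (hu : Integrable fun x => ‖u x‖ ^ (8 / 3 : ℝ)) {R : ℝ}
    (hR : 0 < R) : Integrable fun z : R3 × R3 => ‖u z.1‖ ^ 2 * ‖u z.2‖ ^ 2 *
        (Metric.ball (0 : R3) R).indicator (fun x => ‖x‖⁻¹) (z.1 - z.2) := by
  have hum := (Lp.stronglyMeasurable u).measurable
  have hi : Measurable ((Metric.ball (0 : R3) R).indicator (fun x => ‖x‖⁻¹)) :=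
    Measurable.indicator (by fun_prop) measurableSet_ball
  have hi0 : ∀ x, 0 ≤ (Metric.ball (0 : R3) R).indicator (fun x => ‖x‖⁻¹) x := fun x =>
    Set.indicator_nonneg (fun _ _ => by positivity) _
  refine ⟨Measurable.aestronglyMeasurable (by fun_prop), ?_⟩
  rw [hasFiniteIntegral_iff_ofReal
    (ae_of_all _ fun z => mul_nonneg (by positivity) (hi0 _))]
  exact (lintegral_near_le hu hR one_pos).trans_lt ENNReal.ofReal_lt_top

theorem integrable_coulomb {u : L2R3} (hu : Integrable fun x => ‖u x‖ ^ (8 / 3 : ℝ)) :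
    Integrable fun z : R3 × R3 => ‖u z.1‖ ^ 2 * ‖u z.2‖ ^ 2 / ‖z.1 - z.2‖ := by
  have hum := (Lp.stronglyMeasurable u).measurable
  refine Integrable.mono' ((integrable_near hu one_pos).add
    (integrable_mul_trunc one_pos (integrable_norm_sq u) (integrable_norm_sq u)))
    (Measurable.aestronglyMeasurable (by fun_prop)) (ae_of_all _ fun z => ?_)
  rw [Real.norm_of_nonneg (by positivity)]
  exact coulomb_integrand_le one_pos u z

theorem coulombTrunc_le_coulomb {u : L2R3} (hu : Integrable fun x => ‖u x‖ ^ (8 / 3 : ℝ)) {R : ℝ}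
    (hR : 0 < R) : coulombTrunc R u ≤ coulomb u := by
  -- On the diagonal, division by zero makes the Coulomb integrand 0 and the pointwise comparison
  -- can fail; the diagonal is a null set.
  have hd : ∀ᵐ z : R3 × R3, z.1 - z.2 ≠ 0 := by
    have hs : MeasurableSet {z : R3 × R3 | z.1 - z.2 ≠ 0} :=
      (measurableSet_singleton (0 : R3)).compl.preimage (measurable_fst.sub measurable_snd)
    rw [Measure.volume_eq_prod, Measure.ae_prod_iff_ae_ae hs]
    refine ae_of_all _ fun x => ?_
    filter_upwards [Measure.ae_ne volume x] with y hy
    exact sub_ne_zero.2 hy.symm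
  refine integral_mono_ae
    (integrable_mul_trunc hR (integrable_norm_sq u) (integrable_norm_sq u))
    (integrable_coulomb hu) ?_
  filter_upwards [hd] with z hz
  exact div_le_div_of_nonneg_left (by positivity) (norm_pos_iff.2 hz) (le_max_right _ _)

/-- R and t are kept independent for two uses: R = t² makes the error O(t) at bounded P, while the
choice in `coulomb_le` balances all the terms. -/
theorem coulomb_le_trunc_add {u : L2R3} (hu : Integrable fun x => ‖u x‖ ^ (8 / 3 : ℝ)) {R t : ℝ}
    (hR : 0 < R) (ht : 0 < t) :
    coulomb u ≤ coulombTrunc R u + (t / 2 * lpPow (8 / 3) u ^ 2 +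
        3 * unitVol * R / (2 * t) * lpPow (8 / 3) u) := by
  have hω := unitVol_pos
  have hP := lpPow_nonneg (8 / 3) u
  have hi0 : ∀ x, 0 ≤ (Metric.ball (0 : R3) R).indicator (fun x => ‖x‖⁻¹) x := fun x =>
    Set.indicator_nonneg (fun _ _ => by positivity) _
  have hT := integrable_mul_trunc hR (integrable_norm_sq u) (integrable_norm_sq u)
  have h1 := integral_mono (integrable_coulomb hu) ((integrable_near hu hR).add hT)
    (coulomb_integrand_le hR u)
  rw [integral_add' (integrable_near hu hR) hT] at h1
  have h2 := lintegral_near_le hu hR ht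
  rw [← ofReal_integral_eq_lintegral_ofReal (integrable_near hu hR)
    (ae_of_all _ fun z => mul_nonneg (by positivity) (hi0 _)),
    ENNReal.ofReal_le_ofReal_iff (by positivity)] at h2
  unfold coulomb coulombTrunc
  linarith

/-- The constant in the bound of the Coulomb energy by the exchange energy. -/
def coulombConst : ℝ := 3 / 2 + 3 * unitVol / 2

theorem coulombConst_pos : 0 < coulombConst := by
  have := unitVol_pos
  unfold coulombConst; positivity

theorem lpPow_pos {u : L2R3} (hu : Integrable fun x => ‖u x‖ ^ (8 / 3 : ℝ)) (h0 : u ≠ 0) :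
    0 < lpPow (8 / 3) u := by
  refine lt_of_le_of_ne (lpPow_nonneg _ _) fun h => h0 ?_
  have := (integral_eq_zero_iff_of_nonneg (fun x => by positivity) hu).1 h.symm
  rw [Lp.eq_zero_iff_ae_eq_zero]
  filter_upwards [this] with x hx
  have hx : ‖u x‖ ^ (8 / 3 : ℝ) = 0 := hx
  rw [Real.rpow_eq_zero (norm_nonneg _) (by norm_num)] at hx
  simpa using hx

theorem coulomb_zero : coulomb 0 = 0 := by simp [coulomb]

/-- The Coulomb energy is controlled by the exchange energy:
`C(u) ≤ c ‖u‖_2^{4/3} ‖u‖_{8/3}^{8/3}`. -/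
theorem coulomb_le {u : L2R3} (hu : Integrable fun x => ‖u x‖ ^ (8 / 3 : ℝ)) :
    coulomb u ≤ coulombConst * (‖u‖ ^ 2) ^ (2 / 3 : ℝ) * lpPow (8 / 3) u := by
  have hω := unitVol_pos
  by_cases h0 : u = 0
  · subst h0
    rw [coulomb_zero]
    have := lpPow_nonneg (8 / 3) 0
    have := coulombConst_pos
    positivity
  have hP := lpPow_pos hu h0
  have hn : 0 < ‖u‖ := norm_pos_iff.2 h0
  set P := lpPow (8 / 3) u with hPdef
  obtain ⟨m, hm, hm'⟩ : ∃ m : ℝ, 0 < m ∧ m = (‖u‖ ^ 2) ^ (2 / 3 : ℝ) := ⟨_, by positivity, rfl⟩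
  have hm3 : (‖u‖ ^ 2) ^ 2 = m ^ 3 := by
    rw [hm', ← Real.rpow_natCast ((‖u‖ ^ 2) ^ (2 / 3 : ℝ)), ← Real.rpow_mul (by positivity)]
    norm_num
  -- These values of R and t make the truncated part and both error terms multiples of mP, with
  -- factors 1, 1/2 and 3·unitVol/2, which sum to `coulombConst`.
  have h1 := coulomb_le_trunc_add hu (R := m ^ 2 / P) (t := m / P) (by positivity) (by positivity)
  have h2 := coulombTrunc_le (R := m ^ 2 / P) (by positivity) u
  rw [hm3] at h2
  rw [← hm', coulombConst]
  have e1 : m ^ 3 / (m ^ 2 / P) = m * P := by field_simp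
  have e2 : m / P / 2 * P ^ 2 + 3 * unitVol * (m ^ 2 / P) / (2 * (m / P)) * P =
    m * P / 2 + 3 * unitVol / 2 * (m * P) := by field_simp
  rw [← hPdef, e2] at h1
  rw [e1] at h2
  linarith

/-! ### Behaviour under affine changes of variables -/

section Affine
variable {a : ℝ} (ha : 0 < a) (τ : R3) (u : L2R3)
include ha

theorem lpPow_affineL2 : lpPow (8 / 3) (affineL2 ha τ u) = a * lpPow (8 / 3) u := by
  have h1 : lpPow (8 / 3) (affineL2 ha τ u) =
      ∫ x, (fun x => a ^ 4 * ‖u x‖ ^ (8 / 3 : ℝ)) (a • x + τ) := by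
    refine integral_congr_ae ?_
    filter_upwards [coeFn_affineL2 ha τ u] with x h
    have e : (a ^ (3 / 2 : ℝ)) ^ (8 / 3 : ℝ) = a ^ 4 := by
      rw [← Real.rpow_mul ha.le, ← Real.rpow_natCast]; norm_num
    rw [h, norm_mul, Real.mul_rpow (norm_nonneg _) (norm_nonneg _), Complex.norm_real,
      Real.norm_of_nonneg (by positivity), e]
  rw [h1, integral_affine ha τ (fun x => a ^ 4 * ‖u x‖ ^ (8 / 3 : ℝ)), integral_const_mul, lpPow, smul_eq_mul, ← mul_assoc]
  congr 1
  field_simp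

theorem coulomb_affineL2 : coulomb (affineL2 ha τ u) = a * coulomb u := by
  -- Four factors a^{3/2} give a⁶ and the kernel gives one more a; the Jacobian a⁻⁶ on the product
  -- space leaves a.
  set F : R3 × R3 → ℝ := fun z => a ^ 7 * (‖u z.1‖ ^ 2 * ‖u z.2‖ ^ 2 / ‖z.1 - z.2‖) with hF
  have h1 : coulomb (affineL2 ha τ u) =
      ∫ z : R3 × R3, F (Prod.map (fun x => a • x + τ) (fun x => a • x + τ) z) := by
    refine integral_congr_ae ?_
    have h := coeFn_affineL2 ha τ u
    have e : (a ^ (3 / 2 : ℝ)) ^ 2 = a ^ 3 := by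
      rw [← Real.rpow_natCast, ← Real.rpow_mul ha.le, ← Real.rpow_natCast]; norm_num
    filter_upwards [(Measure.quasiMeasurePreserving_fst (μ := (volume : Measure R3))
        (ν := (volume : Measure R3))).ae h, (Measure.quasiMeasurePreserving_snd
        (μ := (volume : Measure R3)) (ν := (volume : Measure R3))).ae h] with z h1 h2
    rw [h1, h2, hF]
    simp only [Prod.map_fst, Prod.map_snd, norm_mul, Complex.norm_real]
    rw [add_sub_add_right_eq_sub, ← smul_sub, norm_smul, Real.norm_of_nonneg ha.le,
      Real.norm_of_nonneg (by positivity), mul_pow, mul_pow, e]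
    by_cases hz : ‖z.1 - z.2‖ = 0
    · simp [hz]
    · field_simp
  have he : MeasurableEmbedding
      (Prod.map (fun x : R3 => a • x + τ) (fun x : R3 => a • x + τ)) :=
    (measurableEmbedding_affine ha τ).prodMap (measurableEmbedding_affine ha τ)
  have hm := (measurableEmbedding_affine ha τ).measurable
  rw [h1, ← he.integral_map F, Measure.volume_eq_prod, ← Measure.map_prod_map _ _ hm hm,
    map_affine ha, Measure.prod_smul_left, Measure.prod_smul_right, smul_smul,
    integral_smul_measure, integral_const_mul, ← ENNReal.ofReal_mul (by positivity),
    ENNReal.toReal_ofReal (by positivity), smul_eq_mul, ← mul_assoc, coulomb,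
    Measure.volume_eq_prod]
  congr 1
  field_simp

theorem sobolevDensity_affineL2 (s : ℝ) :
    sobolevDensity s (affineL2 ha τ u) =ᵐ[volume] fun ξ =>
      (fun η => (a ^ 3)⁻¹ * ((1 + (a * ‖η‖) ^ 2) ^ s * ‖(𝓕 u : L2R3) η‖ ^ 2)) (a⁻¹ • ξ + 0) := by
  filter_upwards [fourier_affineL2 ha τ u] with ξ h
  rw [sobolevDensity, h, norm_mul, norm_mul, Circle.norm_coe, mul_one, mul_pow,
    norm_affine_const (inv_pos.2 ha), add_zero, norm_smul, Real.norm_of_nonneg (inv_pos.2 ha).le,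
    ← mul_assoc a, mul_inv_cancel₀ ha.ne', one_mul, inv_pow]
  ring

/-- Substitution in frequency moves the dilation onto the weight, leaving û fixed, so that the
integral can be differentiated in a. -/
theorem sobolevNormSq_affineL2 (s : ℝ) :
    sobolevNormSq s (affineL2 ha τ u) =
      ∫ η, (1 + (a * ‖η‖) ^ 2) ^ s * ‖(𝓕 u : L2R3) η‖ ^ 2 := by
  rw [sobolevNormSq, integral_congr_ae (sobolevDensity_affineL2 ha τ u s),
    integral_affine (inv_pos.2 ha) 0
      (fun η => (a ^ 3)⁻¹ * ((1 + (a * ‖η‖) ^ 2) ^ s * ‖(𝓕 u : L2R3) η‖ ^ 2)), integral_const_mul, smul_eq_mul, ← mul_assoc]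
  have : (a⁻¹ ^ 3)⁻¹ * (a ^ 3)⁻¹ = 1 := by field_simp
  rw [this, one_mul]

theorem japanese_scaled_le (η : R3) :
    (1 + (a * ‖η‖) ^ 2) ^ (1 / 2 : ℝ) ≤ (1 + a) * (1 + ‖η‖ ^ 2) ^ (1 / 2 : ℝ) := by
  rw [← Real.sqrt_eq_rpow, ← Real.sqrt_eq_rpow, Real.sqrt_le_left (by positivity), mul_pow,
    mul_pow (1 + a), Real.sq_sqrt (by positivity)]
  nlinarith [sq_nonneg ‖η‖, mul_nonneg ha.le (sq_nonneg ‖η‖)]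

theorem integrable_scaled {u : L2R3} (hu : u ∈ Hhalf) :
    Integrable fun η => (1 + (a * ‖η‖) ^ 2) ^ (1 / 2 : ℝ) * ‖(𝓕 u : L2R3) η‖ ^ 2 := by
  have hm := (Lp.stronglyMeasurable (𝓕 u)).measurable
  refine Integrable.mono' (Integrable.const_mul hu (1 + a))
    (Measurable.aestronglyMeasurable (by fun_prop)) (ae_of_all _ fun η => ?_)
  rw [Real.norm_of_nonneg (by positivity), sobolevDensity, ← mul_assoc]
  exact mul_le_mul_of_nonneg_right (japanese_scaled_le ha η) (by positivity)

theorem Hhalf_affineL2 {u : L2R3} (hu : u ∈ Hhalf) : affineL2 ha τ u ∈ Hhalf := by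
  refine Integrable.congr ?_ (sobolevDensity_affineL2 ha τ u _).symm
  have h := (measurableEmbedding_affine (inv_pos.2 ha) (0 : R3)).integrable_map_iff
    (μ := (volume : Measure R3)) (g := fun η : R3 =>
      (a ^ 3)⁻¹ * ((1 + (a * ‖η‖) ^ 2) ^ (1 / 2 : ℝ) * ‖(𝓕 u : L2R3) η‖ ^ 2))
  rw [map_affine (inv_pos.2 ha)] at h
  exact h.1 (((integrable_scaled ha hu).const_mul _).smul_measure ENNReal.ofReal_ne_top)

end Affine

theorem translateL2_mem_Hhalf (τ : R3) {u : L2R3} (hu : u ∈ Hhalf) : translateL2 τ u ∈ Hhalf := by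
  rw [translateL2_eq_affineL2]
  exact Hhalf_affineL2 _ _ hu

theorem sobolevNormSq_translateL2 (s : ℝ) (τ : R3) (u : L2R3) :
    sobolevNormSq s (translateL2 τ u) = sobolevNormSq s u := by
  rw [translateL2_eq_affineL2, sobolevNormSq_affineL2]
  simp [sobolevNormSq, sobolevDensity]

theorem energy_translateL2 (α β : ℝ) (τ : R3) (u : L2R3) :
    energy α β (8 / 3) (translateL2 τ u) = energy α β (8 / 3) u := by
  rw [energy, sobolevNormSq_translateL2, translateL2_eq_affineL2, coulomb_affineL2,
    lpPow_affineL2, one_mul, one_mul, energy]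

theorem norm_translateL2 (τ : R3) (u : L2R3) : ‖translateL2 τ u‖ = ‖u‖ := by
  rw [translateL2_eq_affineL2, LinearIsometry.norm_map]

/-- Derivative at `a = 1` of the kinetic energy along mass-preserving dilations. -/
theorem hasDerivAt_scaled {u : L2R3} (hu : u ∈ Hhalf) :
    HasDerivAt (fun a : ℝ => ∫ η, (1 + (a * ‖η‖) ^ 2) ^ (1 / 2 : ℝ) * ‖(𝓕 u : L2R3) η‖ ^ 2)
      (sobolevNormSq (1 / 2) u - sobolevNormSq (-(1 / 2)) u) 1 := by
  have hm := (Lp.stronglyMeasurable (𝓕 u)).measurable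
  -- The derivative in a is dominated by |η||û|² uniformly for a near 1, because a|η| ≤ (1 +
  -- a²|η|²)^{1/2}.
  have key := hasDerivAt_integral_of_dominated_loc_of_deriv_le (μ := (volume : Measure R3))
    (F := fun (a : ℝ) (η : R3) => (1 + (a * ‖η‖) ^ 2) ^ (1 / 2 : ℝ) * ‖(𝓕 u : L2R3) η‖ ^ 2)
    (F' := fun (a : ℝ) (η : R3) =>
      (a * ‖η‖ ^ 2 * (1 + (a * ‖η‖) ^ 2) ^ (-(1 / 2) : ℝ)) * ‖(𝓕 u : L2R3) η‖ ^ 2)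
    (x₀ := (1 : ℝ)) (bound := fun η => ‖η‖ * ‖(𝓕 u : L2R3) η‖ ^ 2)
    (Metric.ball_mem_nhds 1 one_pos)
    (Eventually.of_forall fun a => Measurable.aestronglyMeasurable (by fun_prop))
    (integrable_scaled one_pos hu) (Measurable.aestronglyMeasurable (by fun_prop))
    (ae_of_all _ fun η a ha => ?_) (integrable_norm_mul_fourier hu)
    (ae_of_all _ fun η a ha => ?_)
  · refine key.2.congr_deriv ?_
    have hneg : Integrable (sobolevDensity (-(1 / 2)) u) := by
      refine Integrable.mono' (integrable_norm_sq (𝓕 u))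
        (measurable_sobolevDensity _ _).aestronglyMeasurable (ae_of_all _ fun ξ => ?_)
      rw [Real.norm_of_nonneg (sobolevDensity_nonneg _ _ _)]
      refine mul_le_of_le_one_left (by positivity) ?_
      exact Real.rpow_le_one_of_one_le_of_nonpos (by nlinarith [sq_nonneg ‖ξ‖]) (by norm_num)
    rw [sobolevNormSq, sobolevNormSq, ← integral_sub hu hneg]
    refine integral_congr_ae (ae_of_all _ fun η => ?_)
    simp only [sobolevDensity, one_mul]
    rw [← sub_mul]
    congr 1
    -- Here the H^{-1/2} norm appears: |η|²(1+|η|²)^{-1/2} = (1+|η|²)^{1/2} − (1+|η|²)^{-1/2}.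
    have h : (1 + ‖η‖ ^ 2) ^ (1 / 2 : ℝ) = (1 + ‖η‖ ^ 2) * (1 + ‖η‖ ^ 2) ^ (-(1 / 2) : ℝ) := by
      rw [← Real.rpow_one_add' (by positivity) (by norm_num)]
      norm_num
    rw [h]
    ring
  · have ha : 0 < a := by
      rw [Metric.mem_ball, Real.dist_eq, abs_lt] at ha
      linarith
    rw [norm_mul, Real.norm_of_nonneg (by positivity), Real.norm_of_nonneg (by positivity)]
    refine mul_le_mul_of_nonneg_right ?_ (by positivity)
    have h1 : a * ‖η‖ ≤ (1 + (a * ‖η‖) ^ 2) ^ (1 / 2 : ℝ) := by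
      rw [← Real.sqrt_eq_rpow]
      exact Real.le_sqrt_of_sq_le (by linarith)
    have h2 : (1 + (a * ‖η‖) ^ 2) ^ (1 / 2 : ℝ) * (1 + (a * ‖η‖) ^ 2) ^ (-(1 / 2) : ℝ) = 1 := by
      rw [← Real.rpow_add (by positivity)]; simp
    calc a * ‖η‖ ^ 2 * (1 + (a * ‖η‖) ^ 2) ^ (-(1 / 2) : ℝ)
        = ‖η‖ * (a * ‖η‖ * (1 + (a * ‖η‖) ^ 2) ^ (-(1 / 2) : ℝ)) := by ring
      _ ≤ ‖η‖ * ((1 + (a * ‖η‖) ^ 2) ^ (1 / 2 : ℝ) * (1 + (a * ‖η‖) ^ 2) ^ (-(1 / 2) : ℝ)) := by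
          gcongr
      _ = ‖η‖ := by rw [h2, mul_one]
  · refine HasDerivAt.mul_const ?_ _
    have h1 : HasDerivAt (fun a : ℝ => 1 + (a * ‖η‖) ^ 2) (2 * (a * ‖η‖) * ‖η‖) a := by
      have := (((hasDerivAt_id a).mul_const ‖η‖).pow 2).const_add 1
      simpa using this
    have h2 := h1.rpow_const (p := 1 / 2) (Or.inl (by positivity))
    refine h2.congr_deriv ?_
    rw [show (1 / 2 - 1 : ℝ) = -(1 / 2) by norm_num]
    ring

/-! ### The Brezis–Lieb lemma -/

/-- If |b| ≤ δ|a|, continuity of d ↦ (1 ± d)^p at 0 bounds the change from |a|^p by ε|a|^p;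
otherwise |a| ≤ |b|/δ and everything is a multiple of |b|^p. -/
theorem exists_abs_norm_rpow_sub_le {p : ℝ} (hp : 0 < p) {ε : ℝ} (hε : 0 < ε) :
    ∃ C : ℝ, 0 ≤ C ∧ ∀ a b : ℂ, |‖a + b‖ ^ p - ‖a‖ ^ p - ‖b‖ ^ p| ≤ ε * ‖a‖ ^ p + C * ‖b‖ ^ p := by
  have hc : ContinuousAt (fun d : ℝ => ((1 + d) ^ p, (1 - d) ^ p)) 0 := by
    refine ContinuousAt.prodMk ?_ ?_
    · exact (continuousAt_const.add continuousAt_id).rpow_const (Or.inr hp.le)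
    · exact (continuousAt_const.sub continuousAt_id).rpow_const (Or.inr hp.le)
  have h1 : ∀ᶠ d : ℝ in 𝓝 0, (1 + d) ^ p < 1 + ε ∧ 1 - ε < (1 - d) ^ p := by
    have e1 := hc.fst.tendsto.eventually_lt_const (u := 1 + ε) (by simp [hε])
    have e2 := hc.snd.tendsto.eventually_const_lt (u := 1 - ε) (by simp [hε])
    exact e1.and e2
  obtain ⟨δ₀, hδ₀, hball⟩ := Metric.eventually_nhds_iff.1 h1
  obtain ⟨δ, hδ, hδ1, hδ2⟩ : ∃ δ : ℝ, 0 < δ ∧ δ < 1 ∧ δ < δ₀ :=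
    ⟨min (1 / 2) (δ₀ / 2), by positivity, (min_le_left _ _).trans_lt (by norm_num),
      (min_le_right _ _).trans_lt (by linarith)⟩
  obtain ⟨hd1, hd2⟩ := hball (y := δ) (by simpa [abs_of_pos hδ] using hδ2)
  refine ⟨1 + (1 + δ⁻¹) ^ p + δ⁻¹ ^ p, by positivity, fun a b => ?_⟩
  have hx := norm_nonneg a
  have hy := norm_nonneg b
  have hs := norm_nonneg (a + b)
  have hsu : ‖a + b‖ ≤ ‖a‖ + ‖b‖ := norm_add_le a b
  have hsl : ‖a‖ - ‖b‖ ≤ ‖a + b‖ := by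
    have := norm_sub_norm_le a (-b)
    rwa [norm_neg, sub_neg_eq_add] at this
  have hxp : 0 ≤ ‖a‖ ^ p := by positivity
  have hyp : 0 ≤ ‖b‖ ^ p := by positivity
  have hsp : 0 ≤ ‖a + b‖ ^ p := by positivity
  have hA : 0 ≤ (1 + δ⁻¹) ^ p * ‖b‖ ^ p := by positivity
  have hB : 0 ≤ δ⁻¹ ^ p * ‖b‖ ^ p := by positivity
  have hE : 0 ≤ ε * ‖a‖ ^ p := by positivity
  by_cases hc : ‖b‖ ≤ δ * ‖a‖
  · have u1 : ‖a + b‖ ^ p ≤ (1 + δ) ^ p * ‖a‖ ^ p := by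
      rw [← Real.mul_rpow (by positivity) hx]
      exact Real.rpow_le_rpow hs (by linarith) hp.le
    have u2 : (1 - δ) ^ p * ‖a‖ ^ p ≤ ‖a + b‖ ^ p := by
      rw [← Real.mul_rpow (by linarith) hx]
      exact Real.rpow_le_rpow (mul_nonneg (by linarith) hx) (by linarith) hp.le
    have u3 := mul_le_mul_of_nonneg_right hd1.le hxp
    have u4 := mul_le_mul_of_nonneg_right hd2.le hxp
    rw [abs_le]
    constructor <;> nlinarith
  · have hc : ‖a‖ ≤ δ⁻¹ * ‖b‖ := by
      rw [inv_mul_eq_div, le_div_iff₀ hδ]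
      linarith
    have u1 : ‖a + b‖ ^ p ≤ (1 + δ⁻¹) ^ p * ‖b‖ ^ p := by
      rw [← Real.mul_rpow (by positivity) hy]
      exact Real.rpow_le_rpow hs (by linarith) hp.le
    have u2 : ‖a‖ ^ p ≤ δ⁻¹ ^ p * ‖b‖ ^ p := by
      rw [← Real.mul_rpow (by positivity) hy]
      exact Real.rpow_le_rpow hx hc hp.le
    rw [abs_le]
    constructor <;> nlinarith

/-- The Brezis–Lieb lemma. -/
theorem brezis_lieb {X : Type*} [MeasurableSpace X] {μ : Measure X} {p : ℝ} (hp : 0 < p)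
    {f : ℕ → X → ℂ} {g : X → ℂ} {B : ℝ} (hfm : ∀ n, AEStronglyMeasurable (f n) μ)
    (hg : AEStronglyMeasurable g μ)
    (hgi : Integrable (fun x => ‖g x‖ ^ p) μ) (hri : ∀ n, Integrable (fun x => ‖f n x - g x‖ ^ p) μ)
    (hB : ∀ n, ∫ x, ‖f n x - g x‖ ^ p ∂μ ≤ B)
    (hlim : ∀ᵐ x ∂μ, Tendsto (fun n => f n x) atTop (𝓝 (g x))) :
    Tendsto (fun n => ∫ x, |‖f n x‖ ^ p - ‖f n x - g x‖ ^ p - ‖g x‖ ^ p| ∂μ) atTop (𝓝 0) := by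
  have hB0 : 0 ≤ B := (integral_nonneg fun x => by positivity).trans (hB 0)
  rw [Metric.tendsto_atTop]
  intro η hη
  obtain ⟨ε, hε, hεB⟩ : ∃ ε : ℝ, 0 < ε ∧ ε * B < η / 2 := by
    refine ⟨η / (2 * (B + 1)), by positivity, ?_⟩
    rw [div_mul_eq_mul_div, div_lt_div_iff₀ (by positivity) (by norm_num)]
    nlinarith
  obtain ⟨C, hC, hCle⟩ := exists_abs_norm_rpow_sub_le hp hε
  set D : ℕ → X → ℝ := fun n x => |‖f n x‖ ^ p - ‖f n x - g x‖ ^ p - ‖g x‖ ^ p| with hD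
  -- Subtracting ε|f_n − g|^p before taking the positive part leaves something dominated by C|g|^p,
  -- so dominated convergence applies although the f_n have no common majorant.
  set W : ℕ → X → ℝ := fun n x => max (D n x - ε * ‖f n x - g x‖ ^ p) 0 with hW
  have hpm : ∀ {h : X → ℂ}, AEStronglyMeasurable h μ →
      AEStronglyMeasurable (fun x => ‖h x‖ ^ p) μ := fun hh =>
    (Real.continuous_rpow_const hp.le).comp_aestronglyMeasurable hh.norm
  have hDm : ∀ n, AEStronglyMeasurable (D n) μ := fun n =>
    (((hpm (hfm n)).sub (hpm ((hfm n).sub hg))).sub (hpm hg)).norm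
  have hDle : ∀ n x, D n x ≤ ε * ‖f n x - g x‖ ^ p + C * ‖g x‖ ^ p := fun n x => by
    have := hCle (f n x - g x) (g x)
    rwa [sub_add_cancel] at this
  have hDi : ∀ n, Integrable (D n) μ := fun n => by
    refine Integrable.mono' (((hri n).const_mul ε).add (hgi.const_mul C)) (hDm n)
      (ae_of_all _ fun x => ?_)
    rw [Real.norm_of_nonneg (abs_nonneg _)]
    exact hDle n x
  have hWm : ∀ n, AEStronglyMeasurable (W n) μ := fun n =>
    ((hDm n).sub ((hri n).1.const_mul ε)).sup aestronglyMeasurable_const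
  have hWle : ∀ n x, ‖W n x‖ ≤ C * ‖g x‖ ^ p := fun n x => by
    rw [Real.norm_of_nonneg (le_max_right _ _)]
    refine max_le ?_ (by positivity)
    have := hDle n x
    linarith
  have hW0 : Tendsto (fun n => ∫ x, W n x ∂μ) atTop (𝓝 (∫ _, (0 : ℝ) ∂μ)) := by
    refine tendsto_integral_of_dominated_convergence _ hWm (hgi.const_mul C)
      (fun n => ae_of_all _ (hWle n)) ?_
    filter_upwards [hlim] with x hx
    have t1 : Tendsto (fun n => ‖f n x‖ ^ p) atTop (𝓝 (‖g x‖ ^ p)) :=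
      hx.norm.rpow_const (Or.inr hp.le)
    have t2 : Tendsto (fun n => ‖f n x - g x‖ ^ p) atTop (𝓝 0) := by
      have := (hx.sub_const (g x)).norm.rpow_const (p := p) (Or.inr hp.le)
      simpa [Real.zero_rpow hp.ne'] using this
    have t3 := ((t1.sub t2).sub_const (‖g x‖ ^ p)).abs
    have t4 := (t3.sub (t2.const_mul ε)).max (tendsto_const_nhds (x := (0 : ℝ)))
    simpa using t4
  rw [integral_zero] at hW0
  obtain ⟨N, hN⟩ := Metric.tendsto_atTop.1 hW0 (η / 2) (by positivity)
  refine ⟨N, fun n hn => ?_⟩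
  have hWi : Integrable (W n) μ := Integrable.mono' (hgi.const_mul C) (hWm n)
    (ae_of_all _ (hWle n))
  have h1 : ∫ x, D n x ∂μ ≤ ∫ x, W n x ∂μ + ε * ∫ x, ‖f n x - g x‖ ^ p ∂μ := by
    rw [← integral_const_mul, ← integral_add hWi ((hri n).const_mul ε)]
    refine integral_mono (hDi n) (hWi.add ((hri n).const_mul ε)) fun x => ?_
    have := le_max_left (D n x - ε * ‖f n x - g x‖ ^ p) 0
    change D n x ≤ W n x + ε * ‖f n x - g x‖ ^ p
    simp only [hW]
    linarith
  have h2 := hN n hn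
  rw [Real.dist_eq, sub_zero] at h2 ⊢
  rw [abs_of_nonneg (integral_nonneg fun x => abs_nonneg _)]
  have h3 := le_abs_self (∫ x, W n x ∂μ)
  have h4 := mul_le_mul_of_nonneg_left (hB n) hε.le
  change ∫ x, D n x ∂μ < η
  linarith

/-! ### Weak compactness in H^{1/2}. -/

/-- Bounded sequences in `L²` have weakly convergent subsequences. -/
theorem exists_subseq_tendsto_inner {x : ℕ → L2R3} {B : ℝ} (hx : ∀ n, ‖x n‖ ≤ B) :
    ∃ (y : L2R3) (φ : ℕ → ℕ), StrictMono φ ∧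
      ∀ h : L2R3, Tendsto (fun n => (inner ℂ h (x (φ n)) : ℂ)) atTop (𝓝 (inner ℂ h y)) := by
  have : Fact ((2 : ENNReal) ≠ ⊤) := ⟨by norm_num⟩
  have : TopologicalSpace.SeparableSpace L2R3 := inferInstance
  set T : ℕ → WeakDual ℂ L2R3 := fun n =>
    StrongDual.toWeakDual (InnerProductSpace.toDual ℂ L2R3 (x n)) with hT
  obtain ⟨f, -, φ, hφ, hlim⟩ := WeakDual.isSeqCompact_closedBall ℂ L2R3 0 B (x := T) (fun n => by
    simpa [hT] using hx n)
  refine ⟨(InnerProductSpace.toDual ℂ L2R3).symm (WeakDual.toStrongDual f), φ, hφ, fun h => ?_⟩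
  have h1 : Tendsto (fun n => T (φ n) h) atTop (𝓝 (f h)) :=
    ((WeakDual.eval_continuous h).tendsto f).comp hlim
  -- The Riesz map puts x_n in the conjugate-linear slot; conjugation moves it to the second one.
  have h2 := (Complex.continuous_conj.tendsto _).comp h1
  rw [← inner_conj_symm, InnerProductSpace.toDual_symm_apply]
  refine h2.congr fun n => ?_
  simp only [Function.comp, hT]
  rw [← inner_conj_symm]
  rfl

theorem memLp_weight {m : R3 → ℝ} (hm : Measurable m) (h1 : ∀ ξ, |m ξ| ≤ 1) (h : L2R3) :
    MemLp (fun ξ => (m ξ : ℂ) * h ξ) 2 := by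
  have hh := (Lp.stronglyMeasurable h).measurable
  refine (Lp.memLp h).mono (Measurable.aestronglyMeasurable (by fun_prop)) (ae_of_all _ fun ξ => ?_)
  rw [norm_mul, Complex.norm_real]
  exact mul_le_of_le_one_left (norm_nonneg _) (h1 ξ)

theorem measurable_japanese_rpow (s : ℝ) : Measurable fun ξ : R3 => (1 + ‖ξ‖ ^ 2) ^ s := by
  fun_prop

theorem abs_japanese_neg_le (ξ : R3) : |(1 + ‖ξ‖ ^ 2) ^ (-(1 / 4) : ℝ)| ≤ 1 := by
  rw [abs_of_nonneg (by positivity)]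
  exact Real.rpow_le_one_of_one_le_of_nonpos (by nlinarith [sq_nonneg ‖ξ‖]) (by norm_num)

theorem japanese_quarter_sq (ξ : R3) :
    ((1 + ‖ξ‖ ^ 2) ^ (1 / 4 : ℝ)) ^ 2 = (1 + ‖ξ‖ ^ 2) ^ (1 / 2 : ℝ) := by
  rw [← Real.rpow_natCast, ← Real.rpow_mul (by positivity)]; norm_num

theorem japanese_quarter_mul (ξ : R3) :
    (1 + ‖ξ‖ ^ 2) ^ (1 / 4 : ℝ) * (1 + ‖ξ‖ ^ 2) ^ (-(1 / 4) : ℝ) = 1 := by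
  rw [← Real.rpow_add (by positivity)]; simp

theorem memLp_bessel {u : L2R3} (hu : u ∈ Hhalf) :
    MemLp (fun ξ => (((1 + ‖ξ‖ ^ 2) ^ (1 / 4 : ℝ) : ℝ) : ℂ) * (𝓕 u : L2R3) ξ) 2 := by
  have hh := (Lp.stronglyMeasurable (𝓕 u)).measurable
  rw [memLp_two_iff_integrable_sq_norm (Measurable.aestronglyMeasurable (by fun_prop))]
  refine Integrable.congr hu (ae_of_all _ fun ξ => ?_)
  simp only [sobolevDensity]
  rw [norm_mul, mul_pow, Complex.norm_real, Real.norm_of_nonneg (by positivity),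
    japanese_quarter_sq]

/-- The isometry `u ↦ (1 + |ξ|²)^{1/4} û` from `H^{1/2}` to `L²`. -/
def bessel (u : L2R3) (hu : u ∈ Hhalf) : L2R3 := (memLp_bessel hu).toLp _

theorem coeFn_bessel {u : L2R3} (hu : u ∈ Hhalf) : bessel u hu =ᵐ[volume]
    fun ξ => (((1 + ‖ξ‖ ^ 2) ^ (1 / 4 : ℝ) : ℝ) : ℂ) * (𝓕 u : L2R3) ξ := MemLp.coeFn_toLp _

theorem norm_bessel_sq {u : L2R3} (hu : u ∈ Hhalf) :
    ‖bessel u hu‖ ^ 2 = sobolevNormSq (1 / 2) u := by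
  rw [← integral_norm_sq]
  refine integral_congr_ae ?_
  filter_upwards [coeFn_bessel hu] with ξ h
  rw [h, norm_mul, mul_pow, Complex.norm_real, Real.norm_of_nonneg (by positivity),
    japanese_quarter_sq, sobolevDensity]

theorem bessel_sub {u v : L2R3} (hu : u ∈ Hhalf) (hv : v ∈ Hhalf) :
    bessel (u - v) (Hhalf_sub hu hv) = bessel u hu - bessel v hv := by
  refine Lp.ext ?_
  have h0 := Lp.coeFn_sub (𝓕 u) (𝓕 v)
  rw [← fourier_sub] at h0
  filter_upwards [coeFn_bessel hu, coeFn_bessel hv, coeFn_bessel (Hhalf_sub hu hv), h0,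
    Lp.coeFn_sub (bessel u hu) (bessel v hv)] with ξ h1 h2 h3 h4 h5
  rw [h3, h5, Pi.sub_apply, h1, h2, h4, Pi.sub_apply, mul_sub]

/-- Moving the weight to the test function shows that weak convergence of the `bessel` images
implies weak L² convergence of the Fourier transforms. -/
theorem inner_fourier_eq_inner_bessel {u : L2R3} (hu : u ∈ Hhalf) (h : L2R3) :
    (inner ℂ h (𝓕 u) : ℂ) = inner ℂ ((memLp_weight (measurable_japanese_rpow (-(1 / 4)))
      abs_japanese_neg_le h).toLp _) (bessel u hu) := by
  rw [L2.inner_def, L2.inner_def]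
  refine integral_congr_ae ?_
  filter_upwards [(memLp_weight (measurable_japanese_rpow (-(1 / 4)))
      abs_japanese_neg_le h).coeFn_toLp, coeFn_bessel hu] with ξ h1 h2
  rw [h1, h2]
  simp only [RCLike.inner_apply, map_mul, Complex.conj_ofReal]
  have : (((1 + ‖ξ‖ ^ 2) ^ (1 / 4 : ℝ) : ℝ) : ℂ) * (((1 + ‖ξ‖ ^ 2) ^ (-(1 / 4) : ℝ) : ℝ) : ℂ) = 1 := by
    rw [← Complex.ofReal_mul, japanese_quarter_mul, Complex.ofReal_one]
  linear_combination (-(𝓕 u : L2R3) ξ * (starRingEnd ℂ) (h ξ)) * this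

/-- `u ↦ (1 + |ξ|²)^{1/4} û` maps `H^{1/2}` onto `L²`. -/
theorem exists_bessel_eq (g : L2R3) : ∃ (v : L2R3) (hv : v ∈ Hhalf), bessel v hv = g := by
  set W := memLp_weight (measurable_japanese_rpow (-(1 / 4))) abs_japanese_neg_le g with hW
  set v : L2R3 := 𝓕⁻ (W.toLp _ : L2R3) with hv
  have hF : (𝓕 v : L2R3) =ᵐ[volume]
      fun ξ => (((1 + ‖ξ‖ ^ 2) ^ (-(1 / 4) : ℝ) : ℝ) : ℂ) * g ξ := by
    rw [hv, FourierInvPair.fourier_fourierInv_eq]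
    exact W.coeFn_toLp
  have hone : ∀ ξ : R3, (((1 + ‖ξ‖ ^ 2) ^ (1 / 4 : ℝ) : ℝ) : ℂ) *
      (((1 + ‖ξ‖ ^ 2) ^ (-(1 / 4) : ℝ) : ℝ) : ℂ) = 1 := fun ξ => by
    rw [← Complex.ofReal_mul, japanese_quarter_mul, Complex.ofReal_one]
  have hmem : v ∈ Hhalf := by
    refine (integrable_norm_sq g).congr ?_
    filter_upwards [hF] with ξ h
    rw [sobolevDensity, h, ← japanese_quarter_sq, norm_mul, Complex.norm_real,
      Real.norm_of_nonneg (by positivity), ← mul_pow, ← mul_assoc, japanese_quarter_mul, one_mul]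
  refine ⟨v, hmem, Lp.ext ?_⟩
  filter_upwards [coeFn_bessel hmem, hF] with ξ h1 h2
  rw [h1, h2, ← mul_assoc, hone, one_mul]

theorem lowFun_sub (A : ℝ) (u v : L2R3) (x : R3) :
    lowFun A (u - v) x = lowFun A u x - lowFun A v x := by
  rw [lowFun, fourier_sub, inner_sub_right, lowFun, lowFun]

theorem sobolevNormSq_sub_le {u v : L2R3} (hu : u ∈ Hhalf) (hv : v ∈ Hhalf) :
    sobolevNormSq (1 / 2) (u - v) ≤ 2 * (sobolevNormSq (1 / 2) u + sobolevNormSq (1 / 2) v) := by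
  refine (integral_mono_ae (Hhalf_sub hu hv) ((Integrable.add hu hv).const_mul 2)
    (sobolevDensity_sub_le _ _ _)).trans_eq ?_
  rw [integral_const_mul, integral_add' hu hv]
  rfl

/-- Any exponent above the dimension 3 would serve. -/
theorem integrable_weight : Integrable fun x : R3 => (1 + ‖x‖) ^ (-(4 : ℝ)) :=
  integrable_one_add_norm (by simp; norm_num)

theorem weight_le_one (x : R3) : (1 + ‖x‖) ^ (-(4 : ℝ)) ≤ 1 :=
  Real.rpow_le_one_of_one_le_of_nonpos (by linarith [norm_nonneg x]) (by norm_num)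

theorem integrable_norm_sq_mul_weight (r : L2R3) :
    Integrable fun x => ‖r x‖ ^ 2 * (1 + ‖x‖) ^ (-(4 : ℝ)) := by
  have hr := (Lp.stronglyMeasurable r).measurable
  refine (integrable_norm_sq r).mono' (Measurable.aestronglyMeasurable (by fun_prop))
    (ae_of_all _ fun x => ?_)
  rw [Real.norm_of_nonneg (by positivity)]
  exact mul_le_of_le_one_right (by positivity) (weight_le_one x)

/-- Rellich-type compactness: pointwise convergence of low-frequency parts and an `H^{1/2}` bound
give convergence in a weighted `L²` space. -/
theorem tendsto_weighted_of_tendsto_lowFun {r : ℕ → L2R3} {B : ℝ} (hr : ∀ n, r n ∈ Hhalf)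
    (hB : ∀ n, sobolevNormSq (1 / 2) (r n) ≤ B)
    (hlow : ∀ A x, Tendsto (fun n => lowFun A (r n) x) atTop (𝓝 0)) :
    Tendsto (fun n => ∫ x, ‖r n x‖ ^ 2 * (1 + ‖x‖) ^ (-(4 : ℝ))) atTop (𝓝 0) := by
  have hB0 : 0 ≤ B := (sobolevNormSq_nonneg _ _).trans (hB 0)
  rw [Metric.tendsto_atTop]
  intro η hη
  -- The high-frequency remainder has squared norm at most B/A uniformly in n; with A fixed, the
  -- low-frequency part is bounded and is handled by dominated convergence.
  obtain ⟨A, hA, hAB⟩ : ∃ A : ℝ, 0 < A ∧ 2 * (B / A) < η / 2 := by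
    refine ⟨4 * (B + 1) / η, by positivity, ?_⟩
    rw [div_div_eq_mul_div, mul_div_assoc', div_lt_div_iff₀ (by positivity) (by norm_num)]
    nlinarith
  have hlowm : ∀ n, Measurable (lowFun A (r n)) := fun n => (continuous_lowFun A _).measurable
  have hbd : ∀ n x, ‖lowFun A (r n) x‖ ^ 2 ≤ A ^ 3 * unitVol * B := fun n x => by
    have hω := unitVol_pos
    have h1 := norm_lowFun_le hA.le (r n) x
    have h2 := (norm_sq_le_sobolevNormSq (hr n)).trans (hB n)
    calc ‖lowFun A (r n) x‖ ^ 2 ≤ (√(A ^ 3 * unitVol) * ‖r n‖) ^ 2 := by gcongr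
      _ = A ^ 3 * unitVol * ‖r n‖ ^ 2 := by rw [mul_pow, Real.sq_sqrt (by positivity)]
      _ ≤ _ := by gcongr
  have hdom : ∀ n x, ‖‖lowFun A (r n) x‖ ^ 2 * (1 + ‖x‖) ^ (-(4 : ℝ))‖ ≤
      (A ^ 3 * unitVol * B) * (1 + ‖x‖) ^ (-(4 : ℝ)) := fun n x => by
    rw [Real.norm_of_nonneg (by positivity)]
    exact mul_le_mul_of_nonneg_right (hbd n x) (by positivity)
  have hdi := integrable_weight.const_mul (A ^ 3 * unitVol * B)
  have hmm : ∀ n, AEStronglyMeasurable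
      (fun x => ‖lowFun A (r n) x‖ ^ 2 * (1 + ‖x‖) ^ (-(4 : ℝ))) volume := fun n => by
    have := hlowm n
    exact Measurable.aestronglyMeasurable (by fun_prop)
  have hlim : Tendsto (fun n => ∫ x, ‖lowFun A (r n) x‖ ^ 2 * (1 + ‖x‖) ^ (-(4 : ℝ))) atTop
      (𝓝 (∫ _ : R3, (0 : ℝ))) := by
    refine tendsto_integral_of_dominated_convergence _ hmm hdi (fun n => ae_of_all _ (hdom n))
      (ae_of_all _ fun x => ?_)
    have := ((hlow A x).norm.pow 2).mul_const ((1 + ‖x‖) ^ (-(4 : ℝ)))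
    simpa using this
  rw [integral_zero] at hlim
  obtain ⟨N, hN⟩ := Metric.tendsto_atTop.1 hlim (η / 4) (by positivity)
  refine ⟨N, fun n hn => ?_⟩
  have hl := hN n hn
  rw [Real.dist_eq, sub_zero] at hl ⊢
  rw [abs_of_nonneg (integral_nonneg fun x => by positivity)] at hl ⊢
  have hli : Integrable (fun x => ‖lowFun A (r n) x‖ ^ 2 * (1 + ‖x‖) ^ (-(4 : ℝ))) :=
    hdi.mono' (hmm n) (ae_of_all _ (hdom n))
  have hhi := integrable_norm_sq (r n - lowFreq A (r n))
  have hle : ∫ x, ‖r n x‖ ^ 2 * (1 + ‖x‖) ^ (-(4 : ℝ)) ≤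
      2 * (∫ x, ‖lowFun A (r n) x‖ ^ 2 * (1 + ‖x‖) ^ (-(4 : ℝ))) +
        2 * ‖r n - lowFreq A (r n)‖ ^ 2 := by
    rw [← integral_norm_sq, ← integral_const_mul, ← integral_const_mul,
      ← integral_add (hli.const_mul 2) (hhi.const_mul 2)]
    refine integral_mono_ae (integrable_norm_sq_mul_weight _)
      ((hli.const_mul 2).add (hhi.const_mul 2)) ?_
    filter_upwards [Lp.coeFn_sub (r n) (lowFreq A (r n)), lowFreq_ae_eq A (r n)] with x h1 h2
    rw [h1, Pi.sub_apply, h2]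
    have hw := weight_le_one x
    have hw0 : 0 ≤ (1 + ‖x‖) ^ (-(4 : ℝ)) := by positivity
    have h3 : ‖r n x‖ ≤ ‖lowFun A (r n) x‖ + ‖r n x - lowFun A (r n) x‖ := by
      have := norm_add_le (lowFun A (r n) x) (r n x - lowFun A (r n) x)
      rwa [add_sub_cancel] at this
    have h4 : ‖r n x‖ ^ 2 ≤
        2 * ‖lowFun A (r n) x‖ ^ 2 + 2 * ‖r n x - lowFun A (r n) x‖ ^ 2 := by
      nlinarith [norm_nonneg (r n x), sq_nonneg (‖lowFun A (r n) x‖ - ‖r n x - lowFun A (r n) x‖)]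
    have h5 := mul_le_mul_of_nonneg_right h4 hw0
    have h6 : 2 * ‖r n x - lowFun A (r n) x‖ ^ 2 * (1 + ‖x‖) ^ (-(4 : ℝ)) ≤
        2 * ‖r n x - lowFun A (r n) x‖ ^ 2 := mul_le_of_le_one_right (by positivity) hw
    change _ ≤ 2 * (‖lowFun A (r n) x‖ ^ 2 * (1 + ‖x‖) ^ (-(4 : ℝ))) + _
    linarith
  have h7 := (norm_sq_high_le hA (hr n)).trans (div_le_div_of_nonneg_right (hB n) hA.le)
  linarith

/-- Weak compactness in `H^{1/2}`, with convergence almost everywhere. -/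
theorem exists_weak_limit {u : ℕ → L2R3} {B : ℝ} (hu : ∀ n, u n ∈ Hhalf)
    (hB : ∀ n, sobolevNormSq (1 / 2) (u n) ≤ B) :
    ∃ (v : L2R3) (φ : ℕ → ℕ), v ∈ Hhalf ∧ StrictMono φ ∧
      (∀ A x, Tendsto (fun n => lowFun A (u (φ n)) x) atTop (𝓝 (lowFun A v x))) ∧
      Tendsto (fun n => sobolevNormSq (1 / 2) (u (φ n)) - sobolevNormSq (1 / 2) (u (φ n) - v))
        atTop (𝓝 (sobolevNormSq (1 / 2) v)) ∧
      ∀ᵐ x, Tendsto (fun n => u (φ n) x) atTop (𝓝 (v x)) := by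
  have hB0 : 0 ≤ B := (sobolevNormSq_nonneg _ _).trans (hB 0)
  obtain ⟨g, φ, hφ, hlim⟩ := exists_subseq_tendsto_inner (x := fun n => bessel (u n) (hu n))
    (B := √B) fun n => Real.le_sqrt_of_sq_le ((norm_bessel_sq (hu n)).trans_le (hB n))
  obtain ⟨v, hv, rfl⟩ := exists_bessel_eq g
  have hK : Tendsto (fun n => sobolevNormSq (1 / 2) (u (φ n)) -
      sobolevNormSq (1 / 2) (u (φ n) - v)) atTop (𝓝 (sobolevNormSq (1 / 2) v)) := by
    -- In the Hilbert space, ‖x‖² − ‖x − y‖² = 2 Re⟨y, x⟩ − ‖y‖², which is affine in x and so passes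
    -- to the weak limit.
    have h1 := (Complex.continuous_re.tendsto _).comp (hlim (bessel v hv))
    have h2 := (h1.const_mul 2).sub_const (‖bessel v hv‖ ^ 2)
    rw [← norm_bessel_sq hv]
    have e : 2 * Complex.re (inner ℂ (bessel v hv) (bessel v hv)) - ‖bessel v hv‖ ^ 2 =
        ‖bessel v hv‖ ^ 2 := by
      have : Complex.re (inner ℂ (bessel v hv) (bessel v hv)) = ‖bessel v hv‖ ^ 2 :=
        inner_self_eq_norm_sq (𝕜 := ℂ) _
      rw [this]; ring
    rw [e] at h2
    refine h2.congr fun n => ?_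
    rw [← norm_bessel_sq (hu (φ n)), ← norm_bessel_sq (Hhalf_sub (hu (φ n)) hv),
      bessel_sub (hu (φ n)) hv,
      norm_sub_rev, norm_sub_sq (𝕜 := ℂ)]
    simp only [Function.comp, RCLike.re_to_complex]
    ring
  have hlow : ∀ A x, Tendsto (fun n => lowFun A (u (φ n)) x) atTop (𝓝 (lowFun A v x)) := by
    intro A x
    simp only [lowFun]
    rw [inner_fourier_eq_inner_bessel hv]
    simp_rw [inner_fourier_eq_inner_bessel (hu _)]
    exact hlim _
  have hKr : ∀ n, sobolevNormSq (1 / 2) (u (φ n) - v) ≤ 2 * (B + sobolevNormSq (1 / 2) v) :=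
    fun n => (sobolevNormSq_sub_le (hu _) hv).trans (by linarith [hB (φ n)])
  have hw := tendsto_weighted_of_tendsto_lowFun (r := fun n => u (φ n) - v)
    (fun n => Hhalf_sub (hu _) hv) hKr fun A x => by
      simp_rw [lowFun_sub]
      simpa using (hlow A x).sub_const (lowFun A v x)
  -- Weighted L¹ convergence implies convergence in measure, hence almost everywhere along a further
  -- subsequence; the positive weight is then divided out.
  have hmeas : TendstoInMeasure volume
      (fun n x => ‖(u (φ n) - v : L2R3) x‖ ^ 2 * (1 + ‖x‖) ^ (-(4 : ℝ))) atTop (fun _ => (0 : ℝ)) := by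
    refine tendstoInMeasure_of_tendsto_eLpNorm (p := 1) one_ne_zero
      (fun n => (integrable_norm_sq_mul_weight _).1) aestronglyMeasurable_const ?_
    have h2 := ENNReal.tendsto_ofReal hw
    rw [ENNReal.ofReal_zero] at h2
    refine h2.congr fun n => ?_
    rw [eLpNorm_one_eq_lintegral_enorm, ofReal_integral_eq_lintegral_ofReal
      (integrable_norm_sq_mul_weight _) (ae_of_all _ fun x => by positivity)]
    refine lintegral_congr fun x => ?_
    simp only [Pi.sub_apply, sub_zero]
    rw [Real.enorm_eq_ofReal (by positivity)]
  obtain ⟨ψ, hψ, hae⟩ := hmeas.exists_seq_tendsto_ae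
  refine ⟨v, φ ∘ ψ, hv, hφ.comp hψ, fun A x => (hlow A x).comp hψ.tendsto_atTop,
    hK.comp hψ.tendsto_atTop, ?_⟩
  have hsub : ∀ᵐ x, ∀ n, (u (φ (ψ n)) - v : L2R3) x = u (φ (ψ n)) x - v x :=
    ae_all_iff.2 fun n => Lp.coeFn_sub _ _
  filter_upwards [hae, hsub] with x h1 h2
  have hw0 : 0 < (1 + ‖x‖) ^ (-(4 : ℝ)) := by positivity
  have h3 := (h1.mul_const ((1 + ‖x‖) ^ (-(4 : ℝ)))⁻¹).sqrt
  rw [zero_mul, Real.sqrt_zero] at h3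
  rw [tendsto_iff_norm_sub_tendsto_zero]
  refine h3.congr fun n => ?_
  rw [h2, mul_inv_cancel_right₀ hw0.ne', Real.sqrt_sq (norm_nonneg _)]
  rfl

/-! ### Non-vanishing -/

/-- Used to bring a point where the low-frequency part is large to the origin, where the weak limit
detects it. -/
theorem lowFun_translateL2 (A : ℝ) (τ : R3) (u : L2R3) :
    lowFun A (translateL2 τ u) 0 = lowFun A u τ := by
  rw [lowFun_eq_fourierInv, lowFun_eq_fourierInv, Real.fourierInv_eq, Real.fourierInv_eq,
    translateL2_eq_affineL2]
  refine integral_congr_ae ?_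
  filter_upwards [fourier_affineL2 one_pos τ u] with ξ h
  by_cases hξ : ξ ∈ Metric.ball (0 : R3) A
  · rw [Set.indicator_of_mem hξ, Set.indicator_of_mem hξ, h, real_inner_comm τ ξ]
    simp [Circle.smul_def]
  · rw [Set.indicator_of_notMem hξ, Set.indicator_of_notMem hξ, smul_zero, smul_zero]

theorem norm_lowFreq_le (A : ℝ) (u : L2R3) : ‖lowFreq A u‖ ^ 2 ≤ ‖u‖ ^ 2 := by
  rw [← Lp.norm_fourier_eq (lowFreq A u), ← Lp.norm_fourier_eq u, ← integral_norm_sq,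
    ← integral_norm_sq]
  refine integral_mono_ae (integrable_norm_sq _) (integrable_norm_sq _) ?_
  filter_upwards [fourier_lowFreq A u] with ξ h
  rw [h]
  gcongr
  exact norm_indicator_le_norm_self _ _

theorem norm_add_rpow_le {p : ℝ} (hp : 0 ≤ p) (a b : ℂ) :
    ‖a + b‖ ^ p ≤ 2 ^ p * (‖a‖ ^ p + ‖b‖ ^ p) := by
  have h1 : ‖a + b‖ ≤ 2 * max ‖a‖ ‖b‖ :=
    (norm_add_le a b).trans (by linarith [le_max_left ‖a‖ ‖b‖, le_max_right ‖a‖ ‖b‖])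
  refine (Real.rpow_le_rpow (norm_nonneg _) h1 hp).trans ?_
  rw [Real.mul_rpow (by norm_num) (by positivity)]
  refine mul_le_mul_of_nonneg_left ?_ (by positivity)
  have ha : 0 ≤ ‖a‖ ^ p := by positivity
  have hb : 0 ≤ ‖b‖ ^ p := by positivity
  rcases max_choice ‖a‖ ‖b‖ with h | h <;> rw [h] <;> linarith

/-- The low part satisfies |·|^{8/3} ≤ ε^{2/3}|·|², and the high part is small by `lpPow_high_le`.
-/
theorem lpPow_le_low_add_high {A ε : ℝ} {u : L2R3} (hA : 0 < A) (hu : u ∈ Hhalf) (hε : 0 ≤ ε)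
    (h : ∀ x, ‖lowFun A u x‖ ≤ ε) :
    lpPow (8 / 3) u ≤ 2 ^ (8 / 3 : ℝ) * (ε ^ (2 / 3 : ℝ) * ‖u‖ ^ 2 +
      gnConst * (sobolevNormSq (1 / 2) u / A) ^ (1 / 3 : ℝ) * sobolevNormSq (1 / 2) u) := by
  have hl := integrable_norm_sq (lowFreq A u)
  have hh := integrable_lpPow (Hhalf_high A hu)
  have h1 : lpPow (8 / 3) u ≤ 2 ^ (8 / 3 : ℝ) *
      (ε ^ (2 / 3 : ℝ) * ‖lowFreq A u‖ ^ 2 + lpPow (8 / 3) (u - lowFreq A u)) := by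
    rw [lpPow, lpPow, ← integral_norm_sq, ← integral_const_mul,
      ← integral_add (hl.const_mul _) hh, ← integral_const_mul]
    refine integral_mono_ae (integrable_lpPow hu) (((hl.const_mul _).add hh).const_mul _) ?_
    filter_upwards [Lp.coeFn_sub u (lowFreq A u), lowFreq_ae_eq A u] with x h1 h2
    have h3 := norm_add_rpow_le (p := 8 / 3) (by norm_num) (lowFun A u x) (u x - lowFun A u x)
    rw [add_sub_cancel] at h3
    rw [h1, Pi.sub_apply, h2]
    refine h3.trans ?_
    gcongr
    rw [show (8 / 3 : ℝ) = 2 / 3 + (2 : ℕ) by norm_num,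
      Real.rpow_add_natCast' (norm_nonneg _) (by norm_num)]
    have := h x
    gcongr
  refine h1.trans ?_
  have h2 := norm_lowFreq_le A u
  have h3 := lpPow_high_le hA hu
  gcongr

/-- Sequences bounded in `H^{1/2}` with non-vanishing exchange energy have low-frequency parts
that do not vanish uniformly. -/
theorem exists_lowFun_ge {B m δ : ℝ} (hB : 0 < B) (hδ : 0 < δ) :
    ∃ A ε : ℝ, 0 < ε ∧ ∀ u ∈ Hhalf, sobolevNormSq (1 / 2) u ≤ B → ‖u‖ ^ 2 ≤ m →
      δ ≤ lpPow (8 / 3) u → ∃ x, ε ≤ ‖lowFun A u x‖ := by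
  have hg := gnConst_pos
  have hA : ∃ A : ℝ, 0 < A ∧ 2 ^ (8 / 3 : ℝ) * (gnConst * (B / A) ^ (1 / 3 : ℝ) * B) < δ / 2 := by
    have h1 : Tendsto (fun A : ℝ => 2 ^ (8 / 3 : ℝ) * (gnConst * (B / A) ^ (1 / 3 : ℝ) * B)) atTop
        (𝓝 (2 ^ (8 / 3 : ℝ) * (gnConst * 0 ^ (1 / 3 : ℝ) * B))) :=
      ((((tendsto_const_nhds.div_atTop tendsto_id).rpow_const
        (Or.inr (by norm_num))).const_mul _).mul_const _).const_mul _
    rw [Real.zero_rpow (by norm_num), mul_zero, zero_mul, mul_zero] at h1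
    obtain ⟨A, h2, h3⟩ := ((h1.eventually_lt_const (u := δ / 2) (by positivity)).and
      (eventually_gt_atTop 0)).exists
    exact ⟨A, h3, h2⟩
  obtain ⟨A, hA, hAδ⟩ := hA
  have hε : ∃ ε : ℝ, 0 < ε ∧ 2 ^ (8 / 3 : ℝ) * (ε ^ (2 / 3 : ℝ) * m) < δ / 2 := by
    have h1 : Tendsto (fun ε : ℝ => 2 ^ (8 / 3 : ℝ) * (ε ^ (2 / 3 : ℝ) * m)) (𝓝[>] 0)
        (𝓝 (2 ^ (8 / 3 : ℝ) * (0 ^ (2 / 3 : ℝ) * m))) :=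
      (((tendsto_id.mono_left nhdsWithin_le_nhds).rpow_const
        (Or.inr (by norm_num))).mul_const _).const_mul _
    rw [Real.zero_rpow (by norm_num), zero_mul, mul_zero] at h1
    obtain ⟨ε, h2, h3⟩ := ((h1.eventually_lt_const (u := δ / 2) (by positivity)).and
      self_mem_nhdsWithin).exists
    exact ⟨ε, h3, h2⟩
  obtain ⟨ε, hε, hεδ⟩ := hε
  refine ⟨A, ε, hε, fun u hu hK hmu hP => ?_⟩
  by_contra! hcon
  have h1 := lpPow_le_low_add_high hA hu hε.le fun x => (hcon x).le
  have hK0 := sobolevNormSq_nonneg (1 / 2) u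
  have h2 : lpPow (8 / 3) u ≤ 2 ^ (8 / 3 : ℝ) * (ε ^ (2 / 3 : ℝ) * m +
      gnConst * (B / A) ^ (1 / 3 : ℝ) * B) := by
    refine h1.trans ?_
    gcongr
  rw [mul_add] at h2
  linarith

/-! ### Energy estimates at small mass. -/

theorem mem_massSphere_iff {ρ : ℝ} {u : L2R3} : u ∈ massSphere ρ ↔ u ∈ Hhalf ∧ ‖u‖ ^ 2 = ρ := by
  rw [massSphere, Set.mem_ofPred_eq, integral_norm_sq]

theorem coulomb_smul (c : ℂ) (u : L2R3) : coulomb (c • u) = ‖c‖ ^ 4 * coulomb u := by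
  rw [coulomb, coulomb, ← integral_const_mul]
  refine integral_congr_ae ?_
  have h := Lp.coeFn_smul c u
  filter_upwards [(Measure.quasiMeasurePreserving_fst (μ := (volume : Measure R3))
      (ν := (volume : Measure R3))).ae h, (Measure.quasiMeasurePreserving_snd
      (μ := (volume : Measure R3)) (ν := (volume : Measure R3))).ae h] with z h1 h2
  rw [h1, h2, Pi.smul_apply, Pi.smul_apply, norm_smul, norm_smul]
  ring

/-- Coercivity of the energy at small mass. -/
theorem quarter_sobolevNormSq_le_energy {α β ρ : ℝ} (hα : 0 < α) (hβ : 0 < β)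
    (hρ : β * gnConst * ρ ^ (1 / 3 : ℝ) ≤ 1 / 4) {u : L2R3} (hu : u ∈ Hhalf) (hm : ‖u‖ ^ 2 ≤ ρ) :
    1 / 4 * sobolevNormSq (1 / 2) u ≤ energy α β (8 / 3) u := by
  have hK := sobolevNormSq_nonneg (1 / 2) u
  have hC := coulomb_nonneg u
  have hg := gnConst_pos
  have h1 : ‖u‖ ^ (2 / 3 : ℝ) ≤ ρ ^ (1 / 3 : ℝ) := by
    have := Real.rpow_le_rpow (by positivity) hm (z := 1 / 3) (by norm_num)
    rw [← Real.rpow_natCast, ← Real.rpow_mul (norm_nonneg _)] at this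
    norm_num at this ⊢
    exact this
  have h2 : β * lpPow (8 / 3) u ≤ 1 / 4 * sobolevNormSq (1 / 2) u := by
    calc β * lpPow (8 / 3) u
        ≤ β * (gnConst * ρ ^ (1 / 3 : ℝ) * sobolevNormSq (1 / 2) u) := by
          refine mul_le_mul_of_nonneg_left ((lpPow_le hu).trans ?_) hβ.le
          gcongr
      _ = β * gnConst * ρ ^ (1 / 3 : ℝ) * sobolevNormSq (1 / 2) u := by ring
      _ ≤ _ := mul_le_mul_of_nonneg_right hρ hK
  unfold energy
  nlinarith [mul_nonneg hα.le hC]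

/-- Energy per unit mass strictly decreases when a function is scaled up to a larger small mass. -/
theorem exists_massSphere_energy_lt {α β ρ : ℝ} (hα : 0 < α)
    (hρ : 3 * α * coulombConst * ρ ^ (2 / 3 : ℝ) < β) {u : L2R3} (hu : u ∈ Hhalf) (h0 : u ≠ 0)
    (hm : ‖u‖ ^ 2 < ρ) :
    ∃ w ∈ massSphere ρ, ‖u‖ ^ 2 * energy α β (8 / 3) w < ρ * energy α β (8 / 3) u := by
  have hn : 0 < ‖u‖ := norm_pos_iff.2 h0
  have hρ0 : 0 < ρ := (by positivity : (0 : ℝ) < ‖u‖ ^ 2).trans hm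
  have hP := lpPow_pos (integrable_lpPow hu) h0
  have hC := coulomb_le (integrable_lpPow hu)
  have hc0 := coulombConst_pos
  obtain ⟨m, hm0, hmdef⟩ : ∃ m : ℝ, 0 < m ∧ m = ‖u‖ ^ 2 := ⟨_, by positivity, rfl⟩
  rw [← hmdef] at hm hC ⊢
  obtain ⟨s, hs, hsdef⟩ : ∃ s : ℝ, 1 < s ∧ s = ρ / m := ⟨_, by rwa [one_lt_div hm0], rfl⟩
  have hsm : s * m = ρ := by rw [hsdef, div_mul_cancel₀ _ hm0.ne']
  obtain ⟨q, hq, hqdef⟩ : ∃ q : ℝ, 1 < q ∧ q = s ^ (1 / 3 : ℝ) :=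
    ⟨_, Real.one_lt_rpow hs (by norm_num), rfl⟩
  have hq3 : s = q ^ 3 := by
    rw [hqdef, ← Real.rpow_natCast, ← Real.rpow_mul (by linarith)]; norm_num
  have hcn : ‖((√s : ℝ) : ℂ)‖ = √s := by
    rw [Complex.norm_real, Real.norm_of_nonneg (Real.sqrt_nonneg _)]
  have hs2 : √s ^ 2 = s := Real.sq_sqrt (by linarith)
  have hs4 : √s ^ 4 = s ^ 2 := by
    rw [show √s ^ 4 = (√s ^ 2) ^ 2 by ring, hs2]
  have hs83 : √s ^ (8 / 3 : ℝ) = q ^ 4 := by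
    rw [Real.sqrt_eq_rpow, hqdef, ← Real.rpow_mul (by linarith), ← Real.rpow_natCast,
      ← Real.rpow_mul (by linarith)]
    norm_num
  refine ⟨((√s : ℝ) : ℂ) • u, mem_massSphere_iff.2 ⟨Hhalf_smul _ hu, ?_⟩, ?_⟩
  · rw [norm_smul, hcn, mul_pow, hs2, ← hmdef, hsm]
  rw [energy, energy, sobolevNormSq_smul, coulomb_smul, lpPow_smul, hcn, hs2, hs4, hs83, ← hsm]
  have hmq : q ^ 2 * m ^ (2 / 3 : ℝ) = ρ ^ (2 / 3 : ℝ) := by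
    rw [← hsm, Real.mul_rpow (by linarith) hm0.le, hqdef, ← Real.rpow_natCast,
      ← Real.rpow_mul (by linarith)]
    norm_num
  set C := coulomb u
  set P := lpPow (8 / 3) u
  set K := sobolevNormSq (1 / 2) u
  -- Since q⁴ = qs, the difference of the two sides of the goal is sm(α(s−1)C − β(q−1)P). The bound
  -- s − 1 ≤ 3q²(q−1) and q²m^{2/3} = ρ^{2/3} reduce its sign to the smallness hypothesis, which
  -- explains the factor 3 there.
  have key : α * (s - 1) * C < β * (q - 1) * P := by
    have h1 : s - 1 ≤ 3 * q ^ 2 * (q - 1) := by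
      rw [hq3]; nlinarith [mul_nonneg (sub_nonneg.2 hq.le) (sub_nonneg.2 hq.le)]
    have hX : 0 < (q - 1) * P := mul_pos (sub_pos.2 hq) hP
    calc α * (s - 1) * C ≤ α * (3 * q ^ 2 * (q - 1)) * (coulombConst * m ^ (2 / 3 : ℝ) * P) := by
          have := coulomb_nonneg u
          have : 0 ≤ s - 1 := by linarith
          have : 0 ≤ α * (3 * q ^ 2 * (q - 1)) :=
            mul_nonneg hα.le (mul_nonneg (by positivity) (by linarith))
          gcongr
      _ = 3 * α * coulombConst * (q ^ 2 * m ^ (2 / 3 : ℝ)) * ((q - 1) * P) := by ring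
      _ < β * ((q - 1) * P) := by
          rw [hmq]
          exact mul_lt_mul_of_pos_right hρ hX
      _ = β * (q - 1) * P := by ring
  have hsm0 : 0 < s * m := by rw [hsm]; exact hρ0
  have h2 := mul_lt_mul_of_pos_left key hsm0
  have e1 : q ^ 4 = q * s := by rw [hq3]; ring
  rw [e1]
  nlinarith

theorem sqrt_one_add_sq_le {a x : ℝ} (ha : 0 ≤ a) (hx0 : 0 ≤ x) (hx : x ≤ 1) :
    (1 + (a * x) ^ 2) ^ (1 / 2 : ℝ) ≤ 1 + a ^ 2 / 2 := by
  rw [← Real.sqrt_eq_rpow, Real.sqrt_le_left (by positivity)]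
  have h1 : (a * x) ^ 2 ≤ a ^ 2 := by
    have : a * x ≤ a := mul_le_of_le_one_right ha hx
    gcongr
  nlinarith [sq_nonneg (a ^ 2)]

/-- The infimum is strictly below the value `ρ / 2` of vanishing sequences. -/
theorem exists_massSphere_energy_lt_half {α β ρ : ℝ} (hα : 0 < α) (hρ0 : 0 < ρ)
    (hρ : 3 * α * coulombConst * ρ ^ (2 / 3 : ℝ) < β) :
    ∃ w ∈ massSphere ρ, energy α β (8 / 3) w < ρ / 2 := by
  have hω := unitVol_pos
  have hc0 := coulombConst_pos
  obtain ⟨c, hc, hcdef⟩ : ∃ c : ℝ, 0 < c ∧ c = √(ρ / unitVol) := ⟨_, by positivity, rfl⟩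
  -- A function of mass ρ whose transform is constant on the unit ball: for bounded frequencies the
  -- kinetic energy exceeds the mass only quadratically in the dilation parameter.
  set u : L2R3 := 𝓕⁻ ((c : ℂ) • waveKernel 1 0) with hu
  have hFu : 𝓕 u = (c : ℂ) • waveKernel 1 0 := by
    rw [hu, FourierInvPair.fourier_fourierInv_eq]
  have hmass : ‖u‖ ^ 2 = ρ := by
    rw [← Lp.norm_fourier_eq, hFu, norm_smul, mul_pow, norm_waveKernel_sq zero_le_one,
      Complex.norm_real, Real.norm_of_nonneg hc.le, hcdef, Real.sq_sqrt (by positivity)]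
    field_simp
  have hsupp : ∀ᵐ ξ, 1 < ‖ξ‖ → (𝓕 u : L2R3) ξ = 0 := by
    rw [hFu]
    filter_upwards [Lp.coeFn_smul (c : ℂ) (waveKernel 1 0), (memLp_waveKernel 1 0).coeFn_toLp]
      with ξ h1 h2 hξ
    rw [h1, Pi.smul_apply, waveKernel, h2, Set.indicator_of_notMem (by simpa using hξ.le), smul_zero]
  have hpt : ∀ a : ℝ, 0 ≤ a → ∀ᵐ ξ, (1 + (a * ‖ξ‖) ^ 2) ^ (1 / 2 : ℝ) * ‖(𝓕 u : L2R3) ξ‖ ^ 2 ≤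
      (1 + a ^ 2 / 2) * ‖(𝓕 u : L2R3) ξ‖ ^ 2 := by
    intro a ha
    filter_upwards [hsupp] with ξ h
    by_cases hξ : 1 < ‖ξ‖
    · simp [h hξ]
    · exact mul_le_mul_of_nonneg_right (sqrt_one_add_sq_le ha (norm_nonneg _) (not_lt.1 hξ))
        (by positivity)
  have hmem : u ∈ Hhalf := by
    refine Integrable.mono' ((integrable_norm_sq (𝓕 u)).const_mul (1 + 1 ^ 2 / 2))
      (measurable_sobolevDensity _ _).aestronglyMeasurable ?_
    filter_upwards [hpt 1 zero_le_one] with ξ h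
    rw [Real.norm_of_nonneg (sobolevDensity_nonneg _ _ _), sobolevDensity]
    rwa [one_mul] at h
  have hu0 : u ≠ 0 := by
    rintro h
    rw [h] at hmass
    simp at hmass
    exact hρ0.ne hmass
  have hP := lpPow_pos (integrable_lpPow hmem) hu0
  have hC := coulomb_le (integrable_lpPow hmem)
  rw [hmass] at hC
  obtain ⟨D, hD, hDdef⟩ : ∃ D : ℝ, 0 < D ∧ D = β * lpPow (8 / 3) u - α * coulomb u := by
    refine ⟨_, ?_, rfl⟩
    have h1 := mul_le_mul_of_nonneg_left hC hα.le
    have h2 := mul_lt_mul_of_pos_right hρ hP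
    have h3 : 0 < α * (coulombConst * ρ ^ (2 / 3 : ℝ) * lpPow (8 / 3) u) := by positivity
    nlinarith
  -- The dilation parameter λ = 2D/ρ minimizes the upper bound ρ/2 + ρλ²/4 − λD for the energy.
  have hl : 0 < 2 * D / ρ := by positivity
  refine ⟨affineL2 hl 0 u, mem_massSphere_iff.2 ⟨Hhalf_affineL2 hl 0 hmem, ?_⟩, ?_⟩
  · rw [LinearIsometry.norm_map, hmass]
  have hK : sobolevNormSq (1 / 2) (affineL2 hl 0 u) ≤ (1 + (2 * D / ρ) ^ 2 / 2) * ρ := by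
    rw [sobolevNormSq_affineL2, ← hmass, ← Lp.norm_fourier_eq u, ← integral_norm_sq,
      ← integral_const_mul]
    rw [integral_norm_sq, Lp.norm_fourier_eq, hmass]
    exact integral_mono_ae (integrable_scaled hl hmem) ((integrable_norm_sq _).const_mul _)
      (hpt _ hl.le)
  rw [energy, coulomb_affineL2, lpPow_affineL2]
  have e : (2 * D / ρ) ^ 2 * ρ = (2 * D / ρ) * (2 * D) := by field_simp
  nlinarith [mul_pos hl hD]

/-! ### Splitting of mass and energy along weakly convergent sequences. -/

/-- Asymptotic superadditivity of the Coulomb energy. -/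
theorem eventually_coulomb_add_le {y r : ℕ → L2R3} {v : L2R3} {B η : ℝ} (hη : 0 < η)
    (hy : ∀ n, y n ∈ Hhalf) (hr : ∀ n, r n ∈ Hhalf) (hv : v ∈ Hhalf)
    (hyB : ∀ n, ‖y n‖ ^ 2 ≤ B) (hrB : ∀ n, ‖r n‖ ^ 2 ≤ B) (hvB : ‖v‖ ^ 2 ≤ B)
    (hrP : ∀ n, lpPow (8 / 3) (r n) ≤ B) (hvP : lpPow (8 / 3) v ≤ B)
    (he : Tendsto (fun n => ∫ x, |‖y n x‖ ^ 2 - ‖r n x‖ ^ 2 - ‖v x‖ ^ 2|) atTop (𝓝 0)) :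
    ∀ᶠ n in atTop, coulomb v + coulomb (r n) ≤ coulomb (y n) + η := by
  have hω := unitVol_pos
  have hB : 0 ≤ B := (sq_nonneg _).trans hvB
  obtain ⟨t, ht, htη⟩ : ∃ t : ℝ, 0 < t ∧ 2 * (t * (B ^ 2 / 2 + 3 * unitVol / 2 * B)) < η / 2 := by
    refine ⟨η / (8 * (B ^ 2 / 2 + 3 * unitVol / 2 * B + 1)), by positivity, ?_⟩
    rw [div_mul_eq_mul_div, mul_div_assoc', div_lt_div_iff₀ (by positivity) (by norm_num)]
    have : 0 ≤ B ^ 2 / 2 + 3 * unitVol / 2 * B := by positivity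
    nlinarith
  -- Truncation at radius t² costs O(t), uniformly over the remainders; the truncated energies then
  -- split up to the L¹ defect of the densities, which tends to 0 for fixed t.
  have hnear : ∀ w ∈ Hhalf, lpPow (8 / 3) w ≤ B →
      coulomb w ≤ coulombTrunc (t ^ 2) w + t * (B ^ 2 / 2 + 3 * unitVol / 2 * B) := by
    intro w hw hwB
    have hw0 := lpPow_nonneg (8 / 3) w
    refine (coulomb_le_trunc_add (integrable_lpPow hw) (R := t ^ 2) (t := t) (by positivity)
      ht).trans ?_
    have : 3 * unitVol * t ^ 2 / (2 * t) = t * (3 * unitVol / 2) := by field_simp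
    rw [this]
    have h1 : t / 2 * lpPow (8 / 3) w ^ 2 ≤ t / 2 * B ^ 2 := by gcongr
    have h2 : t * (3 * unitVol / 2) * lpPow (8 / 3) w ≤ t * (3 * unitVol / 2) * B := by gcongr
    linarith
  have hsmall := (he.mul_const (3 * B / t ^ 2)).eventually_lt_const (u := η / 2)
    (by rw [zero_mul]; positivity)
  filter_upwards [hsmall] with n hn
  have h1 := hnear v hv hvP
  have h2 := hnear (r n) (hr n) (hrP n)
  have h3 := coulombTrunc_add_le (R := t ^ 2) (by positivity) (y n) v (r n)
  have h4 := coulombTrunc_le_coulomb (integrable_lpPow (hy n)) (R := t ^ 2) (by positivity)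
  have h5 : (∫ x, |‖y n x‖ ^ 2 - ‖r n x‖ ^ 2 - ‖v x‖ ^ 2|) * (‖y n‖ ^ 2 + ‖r n‖ ^ 2 + ‖v‖ ^ 2) /
      t ^ 2 ≤ (∫ x, |‖y n x‖ ^ 2 - ‖r n x‖ ^ 2 - ‖v x‖ ^ 2|) * (3 * B / t ^ 2) := by
    rw [mul_div_assoc]
    refine mul_le_mul_of_nonneg_left ?_ (integral_nonneg fun x => abs_nonneg _)
    refine div_le_div_of_nonneg_right ?_ (by positivity)
    linarith [hyB n, hrB n]
  linarith

theorem tendsto_brezis_lieb_L2R3 {p B : ℝ} (hp : 0 < p) {y : ℕ → L2R3} {v : L2R3}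
    (hv : Integrable fun x => ‖v x‖ ^ p) (hr : ∀ n, Integrable fun x => ‖(y n - v : L2R3) x‖ ^ p)
    (hB : ∀ n, lpPow p (y n - v) ≤ B) (hae : ∀ᵐ x, Tendsto (fun n => y n x) atTop (𝓝 (v x))) :
    Tendsto (fun n => ∫ x, |‖y n x‖ ^ p - ‖(y n - v : L2R3) x‖ ^ p - ‖v x‖ ^ p|) atTop (𝓝 0) := by
  have hsub : ∀ n, (fun x => ‖(y n - v : L2R3) x‖ ^ p) =ᵐ[volume] fun x => ‖y n x - v x‖ ^ p := by
    intro n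
    filter_upwards [Lp.coeFn_sub (y n) v] with x hx
    rw [hx, Pi.sub_apply]
  have h := brezis_lieb hp (f := fun n => y n) (g := v) (B := B)
    (fun n => Lp.aestronglyMeasurable _) (Lp.aestronglyMeasurable _) hv
    (fun n => (hr n).congr (hsub n)) (fun n => by rw [← integral_congr_ae (hsub n)]; exact hB n) hae
  refine h.congr fun n => integral_congr_ae ?_
  filter_upwards [hsub n] with x hx
  rw [hx]

theorem abs_integral_sub_sub_le {X : Type*} [MeasurableSpace X] {μ : Measure X} {f g h : X → ℝ}
    (hf : Integrable f μ) (hg : Integrable g μ) (hh : Integrable h μ) :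
    |∫ x, f x ∂μ - ∫ x, g x ∂μ - ∫ x, h x ∂μ| ≤ ∫ x, |f x - g x - h x| ∂μ := by
  have h1 : ∫ x, f x ∂μ - ∫ x, g x ∂μ - ∫ x, h x ∂μ = ∫ x, (f - g - h) x ∂μ := by
    rw [integral_sub' (hf.sub hg) hh, integral_sub' hf hg]
  rw [h1]
  exact norm_integral_le_integral_norm (μ := μ) (f - g - h)

theorem lpPow_zero_fun : lpPow (8 / 3) 0 = 0 := by
  have h := lpPow_smul (8 / 3) 0 (0 : L2R3)
  rw [smul_zero, norm_zero, Real.zero_rpow (by norm_num), zero_mul] at h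
  exact h

theorem sobolevNormSq_zero_fun (s : ℝ) : sobolevNormSq s 0 = 0 := by
  have h := sobolevNormSq_smul s 0 (0 : L2R3)
  rw [smul_zero, norm_zero, zero_pow two_ne_zero, zero_mul] at h
  exact h

/-- The form of the strict decrease needed for the remainders, which may be zero. -/
theorem norm_sq_mul_le_energy {α β ρ I : ℝ} (hα : 0 < α)
    (hρ : 3 * α * coulombConst * ρ ^ (2 / 3 : ℝ) < β)
    (hI : ∀ u ∈ massSphere ρ, I ≤ energy α β (8 / 3) u) {r : L2R3} (hr : r ∈ Hhalf)
    (hm : ‖r‖ ^ 2 < ρ) : ‖r‖ ^ 2 * I ≤ ρ * energy α β (8 / 3) r := by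
  by_cases h0 : r = 0
  · subst h0
    rw [energy, sobolevNormSq_zero_fun, coulomb_zero, lpPow_zero_fun]
    simp
  · obtain ⟨w, hw, hlt⟩ := exists_massSphere_energy_lt hα hρ hr h0 hm
    exact (mul_le_mul_of_nonneg_left (hI w hw) (sq_nonneg _)).trans hlt.le

/-- Asymptotic splitting of the mass and superadditivity of the energy along weakly convergent
sequences. -/
theorem exists_splitting {α β B : ℝ} (hα : 0 < α) {y : ℕ → L2R3} {v : L2R3}
    (hy : ∀ n, y n ∈ Hhalf) (hyB : ∀ n, sobolevNormSq (1 / 2) (y n) ≤ B) (hv : v ∈ Hhalf)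
    (hK : Tendsto (fun n => sobolevNormSq (1 / 2) (y n) - sobolevNormSq (1 / 2) (y n - v)) atTop
      (𝓝 (sobolevNormSq (1 / 2) v)))
    (hae : ∀ᵐ x, Tendsto (fun n => y n x) atTop (𝓝 (v x))) :
    Tendsto (fun n => ‖y n‖ ^ 2 - ‖y n - v‖ ^ 2) atTop (𝓝 (‖v‖ ^ 2)) ∧
    ∀ η > 0, ∀ᶠ n in atTop, energy α β (8 / 3) v + energy α β (8 / 3) (y n - v) ≤
      energy α β (8 / 3) (y n) + η := by
  have hg := gnConst_pos
  have hB : 0 ≤ B := (sobolevNormSq_nonneg _ _).trans (hyB 0)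
  have hKv := sobolevNormSq_nonneg (1 / 2) v
  have hr : ∀ n, y n - v ∈ Hhalf := fun n => Hhalf_sub (hy n) hv
  obtain ⟨B₁, hB₁⟩ : ∃ B₁, B₁ = 2 * (B + sobolevNormSq (1 / 2) v) := ⟨_, rfl⟩
  have hrK : ∀ n, sobolevNormSq (1 / 2) (y n - v) ≤ B₁ := fun n =>
    (sobolevNormSq_sub_le (hy n) hv).trans (by linarith [hyB n])
  have hB₁0 : 0 ≤ B₁ := by rw [hB₁]; positivity
  obtain ⟨B₂, hB₂⟩ : ∃ B₂, B₂ = gnConst * B₁ ^ (1 / 3 : ℝ) * B₁ := ⟨_, rfl⟩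
  have hPle : ∀ w ∈ Hhalf, sobolevNormSq (1 / 2) w ≤ B₁ → lpPow (8 / 3) w ≤ B₂ := by
    intro w hw hwB
    have hw0 := sobolevNormSq_nonneg (1 / 2) w
    have h1 : ‖w‖ ^ (2 / 3 : ℝ) ≤ B₁ ^ (1 / 3 : ℝ) := by
      have := Real.rpow_le_rpow (by positivity) ((norm_sq_le_sobolevNormSq hw).trans hwB)
        (z := 1 / 3) (by norm_num)
      rw [← Real.rpow_natCast, ← Real.rpow_mul (norm_nonneg _)] at this
      norm_num at this ⊢
      exact this
    rw [hB₂]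
    refine (lpPow_le hw).trans ?_
    gcongr
  have hvB₁ : sobolevNormSq (1 / 2) v ≤ B₁ := by rw [hB₁]; linarith
  have hBL2 := tendsto_brezis_lieb_L2R3 (p := 2) (B := B₁) two_pos
    (by simpa using integrable_norm_sq v) (fun n => by simpa using integrable_norm_sq (y n - v))
    (fun n => by
      have := (norm_sq_le_sobolevNormSq (hr n)).trans (hrK n)
      rw [← integral_norm_sq] at this
      simpa [lpPow] using this) hae
  simp only [Real.rpow_two] at hBL2
  have hBL := tendsto_brezis_lieb_L2R3 (p := 8 / 3) (by norm_num) (integrable_lpPow hv)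
    (fun n => integrable_lpPow (hr n)) (fun n => hPle _ (hr n) (hrK n)) hae
  constructor
  · rw [tendsto_iff_norm_sub_tendsto_zero]
    refine squeeze_zero (fun n => norm_nonneg _) (fun n => ?_) hBL2
    rw [← integral_norm_sq, ← integral_norm_sq, ← integral_norm_sq]
    exact abs_integral_sub_sub_le (integrable_norm_sq _) (integrable_norm_sq _)
      (integrable_norm_sq _)
  · intro η hη
    have hC := eventually_coulomb_add_le (η := η / (4 * α)) (B := max B₁ (max B B₂))
      (by positivity) hy hr hv
      (fun n => ((norm_sq_le_sobolevNormSq (hy n)).trans (hyB n)).trans (by simp))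
      (fun n => ((norm_sq_le_sobolevNormSq (hr n)).trans (hrK n)).trans (le_max_left _ _))
      ((norm_sq_le_sobolevNormSq hv).trans (hvB₁.trans (le_max_left _ _)))
      (fun n => (hPle _ (hr n) (hrK n)).trans (by simp))
      ((hPle v hv hvB₁).trans (by simp)) hBL2
    have hP : ∀ᶠ n in atTop, |β| * |lpPow (8 / 3) (y n) - lpPow (8 / 3) (y n - v)
        - lpPow (8 / 3) v| < η / 4 := by
      have h1 := (hBL.const_mul |β|).eventually_lt_const (u := η / 4)
        (by rw [mul_zero]; positivity)
      filter_upwards [h1] with n hn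
      refine lt_of_le_of_lt (mul_le_mul_of_nonneg_left ?_ (abs_nonneg _)) hn
      exact abs_integral_sub_sub_le (integrable_lpPow (hy n)) (integrable_lpPow (hr n))
        (integrable_lpPow hv)
    have hKe := hK.eventually_const_lt (u := sobolevNormSq (1 / 2) v - η / 4) (by linarith)
    filter_upwards [hC, hP, hKe] with n h1 h2 h3
    have h4 := mul_le_mul_of_nonneg_left h1 hα.le
    have h5 : α * (η / (4 * α)) = η / 4 := by field_simp
    rw [← abs_mul] at h2
    have h6 := (abs_lt.1 h2).2
    unfold energy
    nlinarith

/-! ### Compactness of minimizing sequences. -/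

/-- Compactness of minimizing sequences up to translations. -/
theorem exists_minimizer_of_minimizing {α β ρ I : ℝ} (hα : 0 < α) (hβ : 0 < β)
    (hρa : β * gnConst * ρ ^ (1 / 3 : ℝ) ≤ 1 / 4)
    (hρb : 3 * α * coulombConst * ρ ^ (2 / 3 : ℝ) < β) (hIlt : I < ρ / 2)
    (hI : ∀ u ∈ massSphere ρ, I ≤ energy α β (8 / 3) u) {u : ℕ → L2R3}
    (hu : ∀ n, u n ∈ massSphere ρ)
    (hlim : Tendsto (fun n => energy α β (8 / 3) (u n)) atTop (𝓝 I)) :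
    ∃ φ : ℕ → ℕ, StrictMono φ ∧ ∃ (τ : ℕ → R3) (w : L2R3),
      TendstoHhalf (fun n => translateL2 (τ n) (u (φ n))) w ∧ w ∈ massSphere ρ ∧
        energy α β (8 / 3) w = I := by
  have huH : ∀ n, u n ∈ Hhalf := fun n => (mem_massSphere_iff.1 (hu n)).1
  have hum : ∀ n, ‖u n‖ ^ 2 = ρ := fun n => (mem_massSphere_iff.1 (hu n)).2
  obtain ⟨B, hB0, hB⟩ : ∃ B : ℝ, 0 < B ∧ ∀ n, sobolevNormSq (1 / 2) (u n) ≤ B := by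
    obtain ⟨b, hb⟩ := hlim.bddAbove_range
    refine ⟨4 * |b| + 1, by positivity, fun n => ?_⟩
    have h1 := quarter_sobolevNormSq_le_energy hα hβ hρa (huH n) (hum n).le
    have h2 : energy α β (8 / 3) (u n) ≤ b := hb ⟨n, rfl⟩
    linarith [le_abs_self b]
  -- Once E < (I + ρ/2)/2, the bounds K ≥ ρ and C ≥ 0 give βP ≥ (ρ/2 − I)/2. This holds only from
  -- index N on, hence the shift by N below.
  obtain ⟨δ, hδ, hδdef⟩ : ∃ δ : ℝ, 0 < δ ∧ δ = (ρ / 2 - I) / (2 * β) :=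
    ⟨_, div_pos (by linarith) (by positivity), rfl⟩
  obtain ⟨N, hN⟩ := eventually_atTop.1
    (hlim.eventually_lt_const (u := (I + ρ / 2) / 2) (by linarith))
  have hPδ : ∀ n, δ ≤ lpPow (8 / 3) (u (n + N)) := by
    intro n
    have h1 := hN (n + N) (by omega)
    have h2 := norm_sq_le_sobolevNormSq (huH (n + N))
    rw [hum] at h2
    have h3 := mul_nonneg hα.le (coulomb_nonneg (u (n + N)))
    rw [hδdef, div_le_iff₀ (by positivity)]
    unfold energy at h1
    linarith
  obtain ⟨A, ε, hε, hlow⟩ := exists_lowFun_ge hB0 hδ (m := ρ)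
  choose τ hτ using fun n => hlow (u (n + N)) (huH _) (hB _) (hum _).le (hPδ n)
  set t : ℕ → L2R3 := fun n => translateL2 (τ n) (u (n + N)) with ht
  have htH : ∀ n, t n ∈ Hhalf := fun n => translateL2_mem_Hhalf _ (huH _)
  have htB : ∀ n, sobolevNormSq (1 / 2) (t n) ≤ B := fun n => by
    rw [ht]; simp only []; rw [sobolevNormSq_translateL2]; exact hB _
  have htm : ∀ n, ‖t n‖ ^ 2 = ρ := fun n => by
    rw [ht]; simp only []; rw [norm_translateL2]; exact hum _
  have htE : Tendsto (fun n => energy α β (8 / 3) (t n)) atTop (𝓝 I) := by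
    simp only [ht, energy_translateL2]
    exact hlim.comp (tendsto_add_atTop_nat N)
  obtain ⟨v, φ, hv, hφ, hvlow, hK, hae⟩ := exists_weak_limit htH htB
  have hv0 : v ≠ 0 := by
    rintro rfl
    have h1 : ε ≤ ‖lowFun A (0 : L2R3) 0‖ := by
      refine ge_of_tendsto (hvlow A 0).norm (Eventually.of_forall fun n => ?_)
      rw [ht]
      simp only []
      rw [lowFun_translateL2]
      exact hτ _
    have h2 := lowFun_sub A (0 : L2R3) 0 0
    rw [sub_self, sub_self] at h2
    rw [h2, norm_zero] at h1
    linarith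
  obtain ⟨hmass, hsplit⟩ := exists_splitting (β := β) hα (y := fun n => t (φ n))
    (fun n => htH _) (fun n => htB _) hv hK hae
  have hE : Tendsto (fun n => energy α β (8 / 3) (t (φ n))) atTop (𝓝 I) :=
    htE.comp hφ.tendsto_atTop
  have hrm : Tendsto (fun n => ‖t (φ n) - v‖ ^ 2) atTop (𝓝 (ρ - ‖v‖ ^ 2)) := by
    have := hmass.const_sub ρ
    refine this.congr fun n => ?_
    rw [htm]
    ring
  have hvpos : 0 < ‖v‖ ^ 2 := by
    have := norm_pos_iff.2 hv0
    positivity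
  have hvle : ‖v‖ ^ 2 ≤ ρ := by
    have := ge_of_tendsto' hrm fun n => sq_nonneg _
    linarith
  have hrlt : ∀ᶠ n in atTop, ‖t (φ n) - v‖ ^ 2 < ρ := hrm.eventually_lt_const (by linarith)
  -- The remainder carries at least its share of energy: ρE(r_n) ≥ ‖r_n‖²I with ‖r_n‖² → ρ − ‖v‖².
  -- Subtracting it from ρE(u_n) → ρI leaves at most ‖v‖²I for v.
  have hEv : ρ * energy α β (8 / 3) v ≤ ‖v‖ ^ 2 * I := by
    have hρ : 0 < ρ := hvpos.trans_le hvle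
    refine le_of_forall_pos_le_add fun η hη => ?_
    have h1 : Tendsto (fun n => ρ * (energy α β (8 / 3) (t (φ n)) + η / ρ) -
        ‖t (φ n) - v‖ ^ 2 * I) atTop (𝓝 (ρ * (I + η / ρ) - (ρ - ‖v‖ ^ 2) * I)) :=
      ((hE.add_const _).const_mul _).sub (hrm.mul_const _)
    have e : ρ * (I + η / ρ) - (ρ - ‖v‖ ^ 2) * I = ‖v‖ ^ 2 * I + η := by field_simp; ring
    rw [e] at h1
    refine ge_of_tendsto h1 ?_
    filter_upwards [hrlt, hsplit (η / ρ) (by positivity)] with n h2 h3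
    have h4 := norm_sq_mul_le_energy hα hρb hI (Hhalf_sub (htH (φ n)) hv) h2
    have h5 := mul_le_mul_of_nonneg_left h3 hρ.le
    rw [mul_add] at h5
    linarith
  -- If ‖v‖² < ρ, scaling v up gives ‖v‖²I ≤ ‖v‖²E(w) < ρE(v), against the previous bound.
  have hvρ : ‖v‖ ^ 2 = ρ := by
    by_contra hne
    obtain ⟨w, hw, hlt⟩ := exists_massSphere_energy_lt hα hρb hv hv0 (lt_of_le_of_ne hvle hne)
    have := mul_le_mul_of_nonneg_left (hI w hw) hvpos.le
    linarith
  have hvS : v ∈ massSphere ρ := mem_massSphere_iff.2 ⟨hv, hvρ⟩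
  have hEI : energy α β (8 / 3) v = I := by
    refine le_antisymm ?_ (hI v hvS)
    rw [hvρ] at hEv
    exact le_of_mul_le_mul_left hEv (hvρ ▸ hvpos)
  refine ⟨fun n => φ n + N, fun a b h => by have := hφ h; simp only []; omega, fun n => τ (φ n), v,
    ⟨fun n => htH (φ n), hv, ?_⟩, hvS, hEI⟩
  rw [Metric.tendsto_atTop]
  intro η hη
  -- Two errors of η/8 give E(r_n) < η/4, and coercivity turns this into K(r_n) < η.
  have hEe := hE.eventually_lt_const (u := I + η / 8) (by linarith)
  obtain ⟨N', hN'⟩ := eventually_atTop.1 ((hrlt.and (hsplit (η / 8) (by positivity))).and hEe)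
  refine ⟨N', fun n hn => ?_⟩
  obtain ⟨⟨h1, h2⟩, h3⟩ := hN' n hn
  have h4 := quarter_sobolevNormSq_le_energy hα hβ hρa (Hhalf_sub (htH (φ n)) hv) h1.le
  have h5 := sobolevNormSq_nonneg (1 / 2) (t (φ n) - v)
  rw [Real.dist_eq, sub_zero]
  change |sobolevNormSq (1 / 2) (t (φ n) - v)| < η
  rw [abs_of_nonneg h5]
  linarith

/-! ### The identity for minimizers and the conclusion. -/

/-- The Pohozaev-type identity for functions whose energy is minimal along mass-preserving
dilations. -/
theorem pohozaev_of_dilation_minimal {α β : ℝ} {v : L2R3} (hv : v ∈ Hhalf)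
    (hmin : ∀ (a : ℝ) (ha : 0 < a), energy α β (8 / 3) v ≤ energy α β (8 / 3) (affineL2 ha 0 v)) :
    1 / 2 * sobolevNormSq (1 / 2) v - 1 / 2 * sobolevNormSq (-(1 / 2)) v
      + α * coulomb v - β * lpPow (8 / 3) v = 0 := by
  set F : ℝ → ℝ := fun a =>
    1 / 2 * (∫ η, (1 + (a * ‖η‖) ^ 2) ^ (1 / 2 : ℝ) * ‖(𝓕 v : L2R3) η‖ ^ 2) +
      a * (α * coulomb v - β * lpPow (8 / 3) v) with hF
  have hFa : ∀ a (ha : 0 < a), F a = energy α β (8 / 3) (affineL2 ha 0 v) := by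
    intro a ha
    rw [energy, sobolevNormSq_affineL2, coulomb_affineL2, lpPow_affineL2, hF]
    ring
  have hF1 : F 1 = energy α β (8 / 3) v := by
    simp only [hF, one_mul, energy, sobolevNormSq]
    unfold sobolevDensity
    ring
  have hloc : IsLocalMin F 1 := by
    filter_upwards [lt_mem_nhds (zero_lt_one' ℝ)] with a ha
    rw [hF1, hFa a ha]
    exact hmin a ha
  have hd : HasDerivAt F (1 / 2 * (sobolevNormSq (1 / 2) v - sobolevNormSq (-(1 / 2)) v) +
      1 * (α * coulomb v - β * lpPow (8 / 3) v)) 1 :=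
    ((hasDerivAt_scaled hv).const_mul _).add ((hasDerivAt_id 1).mul_const _)
  have := hloc.hasDerivAt_eq_zero hd
  linarith

/-- The first condition is the one for coercivity, the second the one for strict decrease of energy
per mass; both are strict at ρ = 0 and persist by continuity. -/
theorem exists_small_mass {α β : ℝ} (hβ : 0 < β) :
    ∃ ρbar : ℝ, 0 < ρbar ∧ ∀ ρ : ℝ, 0 < ρ → ρ < ρbar →
      β * gnConst * ρ ^ (1 / 3 : ℝ) ≤ 1 / 4 ∧ 3 * α * coulombConst * ρ ^ (2 / 3 : ℝ) < β := by
  have h1 : ContinuousAt (fun ρ : ℝ => β * gnConst * ρ ^ (1 / 3 : ℝ)) 0 :=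
    (continuousAt_id.rpow_const (Or.inr (by norm_num))).const_mul _
  have h2 : ContinuousAt (fun ρ : ℝ => 3 * α * coulombConst * ρ ^ (2 / 3 : ℝ)) 0 :=
    (continuousAt_id.rpow_const (Or.inr (by norm_num))).const_mul _
  have e1 := h1.tendsto.eventually_lt_const (u := 1 / 4)
    (by rw [Real.zero_rpow (by norm_num)]; norm_num)
  have e2 := h2.tendsto.eventually_lt_const (u := β)
    (by rw [Real.zero_rpow (by norm_num), mul_zero]; exact hβ)
  obtain ⟨r, hr, hball⟩ := Metric.eventually_nhds_iff.1 (e1.and e2)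
  refine ⟨r, hr, fun ρ h0 hlt => ?_⟩
  obtain ⟨h3, h4⟩ := hball (y := ρ) (by rwa [Real.dist_eq, sub_zero, abs_of_pos h0])
  exact ⟨h3.le, h4⟩

end

theorem theorem1p3 (α β : ℝ) (hα : 0 < α) (hβ : 0 < β) :
    ∃ ρbar : ℝ, 0 < ρbar ∧ ∀ ρ : ℝ, 0 < ρ → ρ < ρbar →
      0 ≤ infEnergy α β (8 / 3) ρ ∧
      (∀ u : ℕ → L2R3, IsMinimizingSeq α β (8 / 3) ρ u →
        ∃ φ : ℕ → ℕ, StrictMono φ ∧ ∃ (τ : ℕ → R3) (w : L2R3),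
          TendstoHhalf (fun n => translateL2 (τ n) (u (φ n))) w) ∧
      (∃ v : L2R3, IsEnergyMinimizer α β (8 / 3) ρ v) ∧
      (∀ v : L2R3, IsEnergyMinimizer α β (8 / 3) ρ v →
        1 / 2 * sobolevNormSq (1 / 2) v - 1 / 2 * sobolevNormSq (-(1 / 2)) v
          + α * coulomb v - β * lpPow (8 / 3) v = 0) := by
  obtain ⟨ρbar, hρbar, hsmall⟩ := exists_small_mass (α := α) hβ
  refine ⟨ρbar, hρbar, fun ρ hρ hlt => ?_⟩
  obtain ⟨hρa, hρb⟩ := hsmall ρ hρ hlt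
  have hnonneg : 0 ≤ infEnergy α β (8 / 3) ρ := by
    refine le_iInf₂ fun u hu => ?_
    obtain ⟨huH, hum⟩ := mem_massSphere_iff.1 hu
    have h1 := quarter_sobolevNormSq_le_energy hα hβ hρa huH hum.le
    have h2 := sobolevNormSq_nonneg (1 / 2) u
    exact_mod_cast (by linarith : 0 ≤ energy α β (8 / 3) u)
  have hle : ∀ u ∈ massSphere ρ, infEnergy α β (8 / 3) ρ ≤ (energy α β (8 / 3) u : EReal) :=
    fun u hu => iInf₂_le u hu
  obtain ⟨w₀, hw₀, hw₀lt⟩ := exists_massSphere_energy_lt_half hα hρ hρb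
  -- The infimum is finite: bounded below by 0, and above by the energy of the competitor w₀.
  obtain ⟨I, hIeq⟩ : ∃ I : ℝ, infEnergy α β (8 / 3) ρ = (I : EReal) := by
    refine ⟨(infEnergy α β (8 / 3) ρ).toReal, (EReal.coe_toReal ?_ ?_).symm⟩
    · exact ((hle w₀ hw₀).trans_lt (EReal.coe_lt_top _)).ne
    · exact (lt_of_lt_of_le (EReal.bot_lt_coe 0) hnonneg).ne'
  have hI : ∀ u ∈ massSphere ρ, I ≤ energy α β (8 / 3) u := fun u hu => by
    have := hle u hu
    rw [hIeq] at this
    exact_mod_cast this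
  have hIlt : I < ρ / 2 := (hI w₀ hw₀).trans_lt hw₀lt
  have hmain := fun (u : ℕ → L2R3) (hu : ∀ n, u n ∈ massSphere ρ)
    (hlim : Tendsto (fun n => energy α β (8 / 3) (u n)) atTop (𝓝 I)) =>
      exists_minimizer_of_minimizing hα hβ hρa hρb hIlt hI hu hlim
  refine ⟨hnonneg, fun u hu => ?_, ?_, fun v hv => ?_⟩
  · obtain ⟨hS, hT⟩ := hu
    rw [hIeq] at hT
    obtain ⟨φ, hφ, τ, w, hw, -, -⟩ := hmain u hS (EReal.tendsto_coe.1 hT)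
    exact ⟨φ, hφ, τ, w, hw⟩
  · have hseq : ∀ n : ℕ, ∃ u ∈ massSphere ρ, energy α β (8 / 3) u < I + 1 / ((n : ℝ) + 1) := by
      intro n
      have hpos : (0 : ℝ) < 1 / ((n : ℝ) + 1) := by positivity
      have h1 : infEnergy α β (8 / 3) ρ < ((I + 1 / ((n : ℝ) + 1) : ℝ) : EReal) := by
        rw [hIeq]
        exact_mod_cast (by linarith : I < I + 1 / ((n : ℝ) + 1))
      obtain ⟨u, hu⟩ := iInf_lt_iff.1 h1
      obtain ⟨huS, hu⟩ := iInf_lt_iff.1 hu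
      exact ⟨u, huS, by exact_mod_cast hu⟩
    choose u huS hulim using hseq
    have hlim : Tendsto (fun n => energy α β (8 / 3) (u n)) atTop (𝓝 I) := by
      refine tendsto_of_tendsto_of_tendsto_of_le_of_le tendsto_const_nhds ?_
        (fun n => hI _ (huS n)) (fun n => (hulim n).le)
      simpa using tendsto_one_div_add_atTop_nhds_zero_nat.const_add I
    obtain ⟨-, -, -, w, -, hwS, hwE⟩ := hmain u huS hlim
    exact ⟨w, hwS, by rw [hwE, hIeq]⟩
  · obtain ⟨hvS, hvE⟩ := hv
    obtain ⟨hvH, hvm⟩ := mem_massSphere_iff.1 hvS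
    refine pohozaev_of_dilation_minimal hvH fun a ha => ?_
    have hS : affineL2 ha 0 v ∈ massSphere ρ :=
      mem_massSphere_iff.2 ⟨Hhalf_affineL2 ha 0 hvH, by rw [LinearIsometry.norm_map, hvm]⟩
    have := hI _ hS
    rw [hIeq] at hvE
    have hvE' : energy α β (8 / 3) v = I := by exact_mod_cast hvE
    rwa [hvE']
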